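/- Let $\mathbb N=\{1,2,\dots\}$, let $A$ be a Borel subset of $\mathbb R$ with the order inherited from $\mathbb R$, and let $0<q<1$. For a word $w=w_1w_2\cdots\in A^\infty$ let $\mathrm{inv}_n(w)=\#\{(i,j): 1\le i<j\le n,\ w_i>w_j\}$. For a permutation $\sigma$ of $\mathbb N$ moving only finitely many integers, let $(T_\sigma w)_i=w_{\sigma^{-1}(i)}$ and let $c(\sigma,w)$ be the eventually constant value of $\mathrm{inv}_n(T_\sigma w)-\mathrm{inv}_n(w)$ as $n\to\infty$. A Borel probability measure $P$ on $A^\infty$ is called $q$-exchangeable if for every such $\sigma$ the measure $X\mapsto P(T_\sigma X)$ is equivalent to $P$, with Radon–Nikodym derivative $w\mapsto q^{c(\sigma,w)}$. For $v\in A^\infty$ let $P^{(v)}$ be the law of the infinite $q$-shuffle of $v$, that is, of the random word $w_1w_2\cdots$ built as follows from independent random variables $\xi_1,\xi_2,\dots$ with $\Pr(\xi_m=i)=(1-q)q^{i-1}$, $i=1,2,\dots$: put $v^{(1)}=v$; at step $m$ let $w_m$ be the $\xi_m$-th letter of $v^{(m)}$, and let $v^{(m+1)}$ be $v^{(m)}$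 with this letter removed. Then $v\mapsto P^{(v)}$ is a bijection from the set of inversion-free words $v=v_1v_2\cdots\in A^\infty$ (those with $v_1\le v_2\le\cdots$) onto the set of extreme points of the convex set of $q$-exchangeable Borel probability measures on $A^\infty$. -/

import Mathlib

open MeasureTheory ProbabilityTheory Filter
open scoped NNReal ENNReal

namespace QExch

/-! Infinite words over an alphabet `α` are functions `ℕ → α`; positions are numbered from `0`. -/

/-- The action of a permutation of positions on infinite words: `(T_σ w)_i = w_{σ⁻¹ i}`. -/
def permWord {α : Type*} (σ : Equiv.Perm ℕ) (w : ℕ → α) : ℕ → α :=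
  fun i => w (σ⁻¹ i)

/-- The permutation `σ` moves only finitely many positions. -/
def IsFinitary (σ : Equiv.Perm ℕ) : Prop :=
  {i | σ i ≠ i}.Finite

/-- The number of inversions in the first `n` letters of `w`. -/
def invCount {α : Type*} [LinearOrder α] (n : ℕ) (w : ℕ → α) : ℕ :=
  ((Finset.range n ×ˢ Finset.range n).filter (fun p => p.1 < p.2 ∧ w p.2 < w p.1)).card

/-- The additive cocycle: the stable value (for large `n`) of
`inv_n (T_σ w) - inv_n w`; for finitary `σ` the sequence is eventually constant,
see `cocycle_eq`. -/
noncomputable def cocycle {α : Type*} [LinearOrder α] (σ : Equiv.Perm ℕ) (w : ℕ → α) : ℤ :=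
  limUnder atTop (fun n : ℕ => (invCount n (permWord σ w) : ℤ) - (invCount n w : ℤ))

/-- A measure `P` on infinite words is `q`-exchangeable if, for every finitary `σ`, the measure
`X ↦ P (T_σ X)` (the push-forward of `P` under the inverse `T_{σ⁻¹}` of `T_σ`) is equivalent
to `P`, with Radon-Nikodym derivative `w ↦ q ^ cocycle σ w`. -/
def IsQExchangeable {α : Type*} [LinearOrder α] [MeasurableSpace α] (q : ℝ)
    (P : Measure (ℕ → α)) : Prop :=
  ∀ σ : Equiv.Perm ℕ, IsFinitary σ →
    P.map (permWord σ⁻¹) ≪ P ∧ P ≪ P.map (permWord σ⁻¹) ∧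
      P.map (permWord σ⁻¹) = P.withDensity (fun w => ENNReal.ofReal (q ^ cocycle σ w))

/-- The convex set of all `q`-exchangeable probability measures on infinite words. -/
def qExchangeableMeasures (α : Type*) [LinearOrder α] [MeasurableSpace α] (q : ℝ) :
    Set (Measure (ℕ → α)) :=
  {P | IsProbabilityMeasure P ∧ IsQExchangeable q P}

/-- The word obtained from `v` by deleting the letter in position `k`. -/
def deleteAt {α : Type*} (v : ℕ → α) (k : ℕ) : ℕ → α :=
  fun i => if i < k then v i else v (i + 1)

/-- The word remaining after `m` steps of the shuffle of `v` when the successive choices are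
`ξ 0, ξ 1, …`. -/
def remainder {α : Type*} (v : ℕ → α) (ξ : ℕ → ℕ) : ℕ → (ℕ → α)
  | 0 => v
  | m + 1 => deleteAt (remainder v ξ m) (ξ m)

/-- The output of the shuffle: at step `m`, the letter in position `ξ m` of the remaining word
is chosen as the next letter, and then deleted. -/
def shuffleWord {α : Type*} (v : ℕ → α) (ξ : ℕ → ℕ) : ℕ → α :=
  fun m => remainder v ξ m (ξ m)

/-- The geometric distribution giving mass `(1 - q) q ^ i` to the position `i = 0, 1, 2, …`. -/
noncomputable def geomLaw (q : ℝ) (h0 : 0 < q) (h1 : q < 1) : Measure ℕ :=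
  geometricMeasure ⟨1 - q, by linarith, by linarith⟩

instance geomLaw_isProbabilityMeasure (q : ℝ) (h0 : 0 < q) (h1 : q < 1) :
    IsProbabilityMeasure (geomLaw q h0 h1) := by
  unfold geomLaw; infer_instance

/-- The law `P^(v)` of the infinite `q`-shuffle of the word `v`, driven by independent choices
`ξ 0, ξ 1, …`, each with the geometric distribution. -/
noncomputable def shuffleLaw {α : Type*} [MeasurableSpace α] (q : ℝ) (h0 : 0 < q) (h1 : q < 1)
    (v : ℕ → α) : Measure (ℕ → α) :=
  (Measure.infinitePi (fun _ : ℕ => geomLaw q h0 h1)).map (shuffleWord v)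

/-! Checks that no junk value is involved in the definitions above. -/

theorem geomLaw_singleton (q : ℝ) (h0 : 0 < q) (h1 : q < 1) (i : ℕ) :
    geomLaw q h0 h1 {i} = ENNReal.ofReal ((1 - q) * q ^ i) := by
  have h : (⟨1 - q, by linarith, by linarith⟩ : unitInterval) ≠ 0 := by
    intro h
    have := congrArg Subtype.val h
    simp only [Set.Icc.coe_zero] at this
    linarith
  rw [geomLaw, geometricMeasure_singleton h]
  congr 1
  simp only [sub_sub_cancel]
  ring

theorem measurable_remainder {α : Type*} [MeasurableSpace α] (v : ℕ → α) (m i : ℕ) :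
    Measurable (fun ξ : ℕ → ℕ => remainder v ξ m i) := by
  induction m generalizing i with
  | zero => exact measurable_const
  | succ m ih =>
    refine Measurable.ite ?_ (ih i) (ih (i + 1))
    exact measurableSet_lt measurable_const (measurable_pi_apply m)

theorem measurable_shuffleWord {α : Type*} [MeasurableSpace α] (v : ℕ → α) :
    Measurable (shuffleWord v) := by
  refine measurable_pi_lambda _ fun m => ?_
  have h : Measurable (fun p : (ℕ → ℕ) × ℕ => remainder v p.1 m p.2) :=
    measurable_from_prod_countable_left fun i => measurable_remainder v m i
  exact h.comp (measurable_id.prodMk (measurable_pi_apply m))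

theorem isProbabilityMeasure_shuffleLaw {α : Type*} [MeasurableSpace α] (q : ℝ) (h0 : 0 < q)
    (h1 : q < 1) (v : ℕ → α) : IsProbabilityMeasure (shuffleLaw q h0 h1 v) :=
  Measure.isProbabilityMeasure_map (measurable_shuffleWord v).aemeasurable

theorem invCount_succ {α : Type*} [LinearOrder α] (n : ℕ) (w : ℕ → α) :
    invCount (n + 1) w =
      invCount n w + ((Finset.range n).filter (fun i => w n < w i)).card := by
  have h : (Finset.range (n + 1) ×ˢ Finset.range (n + 1)).filter
        (fun p => p.1 < p.2 ∧ w p.2 < w p.1) =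
      (Finset.range n ×ˢ Finset.range n).filter (fun p => p.1 < p.2 ∧ w p.2 < w p.1) ∪
        ((Finset.range n).filter (fun i => w n < w i)).image (fun i => (i, n)) := by
    ext ⟨a, b⟩
    simp only [Finset.mem_filter, Finset.mem_product, Finset.mem_range, Finset.mem_union,
      Finset.mem_image, Prod.mk.injEq]
    constructor
    · rintro ⟨⟨ha, hb⟩, hab, hw⟩
      rcases Nat.lt_succ_iff_lt_or_eq.1 hb with hb | rfl
      · exact Or.inl ⟨⟨by omega, hb⟩, hab, hw⟩
      · exact Or.inr ⟨a, ⟨hab, hw⟩, rfl, rfl⟩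
    · rintro (⟨⟨ha, hb⟩, hab, hw⟩ | ⟨c, ⟨hc, hw⟩, rfl, rfl⟩)
      · exact ⟨⟨by omega, by omega⟩, hab, hw⟩
      · exact ⟨⟨by omega, by omega⟩, hc, hw⟩
  rw [invCount, h, Finset.card_union_of_disjoint, Finset.card_image_of_injective]
  · rfl
  · intro a b hab
    exact (Prod.mk.inj hab).1
  · rw [Finset.disjoint_left]
    rintro ⟨a, b⟩ h1 h2
    simp only [Finset.mem_filter, Finset.mem_product, Finset.mem_range, Finset.mem_image,
      Prod.mk.injEq] at h1 h2
    obtain ⟨c, -, -, rfl⟩ := h2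
    omega

theorem invCount_diff_eq {α : Type*} [LinearOrder α] (σ : Equiv.Perm ℕ) (w : ℕ → α) (N : ℕ)
    (hN : ∀ i, N ≤ i → σ i = i) (n : ℕ) (hn : N ≤ n) :
    (invCount n (permWord σ w) : ℤ) - invCount n w =
      (invCount N (permWord σ w) : ℤ) - invCount N w := by
  have hinv : ∀ i, N ≤ i → σ⁻¹ i = i := fun i hi => by
    rw [Equiv.Perm.inv_eq_iff_eq, hN i hi]
  induction n, hn using Nat.le_induction with
  | base => rfl
  | succ n hn ih =>
    have hlt : ∀ τ : Equiv.Perm ℕ, (∀ i, N ≤ i → τ i = i) → ∀ i, i < n → τ i < n := by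
      intro τ hτ i hi
      by_contra hcon
      have h2 : τ (τ i) = τ i := hτ _ (by omega)
      have := τ.injective h2
      omega
    have hcard : ((Finset.range n).filter (fun i => permWord σ w n < permWord σ w i)).card =
        ((Finset.range n).filter (fun i => w n < w i)).card := by
      refine Finset.card_bij' (fun i _ => σ⁻¹ i) (fun i _ => σ i) ?_ ?_ ?_ ?_
      · intro i hi
        simp only [Finset.mem_filter, Finset.mem_range, permWord, hinv n hn] at hi ⊢
        exact ⟨hlt _ hinv i hi.1, hi.2⟩
      · intro i hi
        simp only [Finset.mem_filter, Finset.mem_range, permWord, hinv n hn] at hi ⊢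
        rw [show σ⁻¹ (σ i) = i by simp]
        exact ⟨hlt _ hN i hi.1, hi.2⟩
      · intro i _
        simp
      · intro i _
        simp
    rw [invCount_succ, invCount_succ, hcard]
    push_cast
    linarith

theorem cocycle_eq {α : Type*} [LinearOrder α] (σ : Equiv.Perm ℕ) (w : ℕ → α) (N : ℕ)
    (hN : ∀ i, N ≤ i → σ i = i) :
    cocycle σ w = (invCount N (permWord σ w) : ℤ) - invCount N w := by
  refine Tendsto.limUnder_eq (tendsto_const_nhds.congr' ?_)
  filter_upwards [eventually_ge_atTop N] with n hn
  exact (invCount_diff_eq σ w N hN n hn).symm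

end QExch

namespace QExch

/-! ### Finitary permutations and adjacent transpositions -/

section Permutations

variable {α : Type*}

/-! Say that w sorts to v if, for each j, the j-th order statistic of the first n letters of w
equals v_j for all large n (`SortsTo`). The proof rests on two facts about a q-exchangeable
probability P.

Almost every word sorts to some v. Moving letter n to the front changes the inversion number by the
number of smaller minus the number of larger letters before it. If fewer than k earlier letters are
at most letter n, the density of this move is at least q^(2k-n); as the density has mean 1, this has
probability at most q^(n-2k). By Borel–Cantelli every order statistic stabilizes
(`ae_exists_sortsTo`).

The sorted word determines the law. Averaging a function, with weights, over the rearrangements of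
the first n letters preserves its P-integral (`lintegral_permAverage`). For a cylinder event C the
average at w is the probability of C for a finite q-shuffle of the sorted prefix, and it tends to
P^(v)(C) if w sorts to v (`tendsto_permAverage`). Hence P = P^(v) as soon as almost every word sorts
to the same v (`eq_shuffleLaw_of_ae_sortsTo`).

For increasing v, P^(v) is q-exchangeable, because exchanging two successive output letters comes
from an involution of the choices that changes their probability by a factor q or q⁻¹. Almost surely
the shuffle uses every letter, so its output sorts to v; this gives injectivity. Any component of
P^(v) is also carried by words sorting to v, hence equals P^(v), which is therefore extreme.
Conversely, an extreme P is trivial on events invariant under finitary permutations; countably many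
such events determine the sorted word, so it is almost surely constant and P is a shuffle law. -/

theorem permWord_one (w : ℕ → α) : permWord 1 w = w := rfl

theorem permWord_mul (σ τ : Equiv.Perm ℕ) (w : ℕ → α) :
    permWord (σ * τ) w = permWord σ (permWord τ w) := by
  funext i
  simp [permWord, mul_inv_rev]

theorem permWord_inv_self (σ : Equiv.Perm ℕ) (w : ℕ → α) :
    permWord σ⁻¹ (permWord σ w) = w := by
  rw [← permWord_mul, inv_mul_cancel, permWord_one]

theorem permWord_self_inv (σ : Equiv.Perm ℕ) (w : ℕ → α) :
    permWord σ (permWord σ⁻¹ w) = w := by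
  rw [← permWord_mul, mul_inv_cancel, permWord_one]

/-- The permutation `σ` fixes every position from `n` on. -/
def FixesFrom (n : ℕ) (σ : Equiv.Perm ℕ) : Prop :=
  ∀ i, n ≤ i → σ i = i

theorem FixesFrom.mono {m n : ℕ} (h : m ≤ n) {σ : Equiv.Perm ℕ} (hσ : FixesFrom m σ) :
    FixesFrom n σ :=
  fun i hi => hσ i (h.trans hi)

theorem FixesFrom.mul {n : ℕ} {σ τ : Equiv.Perm ℕ} (hσ : FixesFrom n σ) (hτ : FixesFrom n τ) :
    FixesFrom n (σ * τ) := by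
  intro i hi
  rw [Equiv.Perm.mul_apply, hτ i hi, hσ i hi]

theorem FixesFrom.inv {n : ℕ} {σ : Equiv.Perm ℕ} (hσ : FixesFrom n σ) : FixesFrom n σ⁻¹ := by
  intro i hi
  rw [Equiv.Perm.inv_eq_iff_eq, hσ i hi]

theorem FixesFrom.lt {n : ℕ} {σ : Equiv.Perm ℕ} (hσ : FixesFrom n σ) {i : ℕ} (hi : i < n) :
    σ i < n := by
  by_contra hcon
  have := σ.injective (hσ (σ i) (by omega))
  omega

theorem fixesFrom_swap {m n : ℕ} (h : m + 1 < n) : FixesFrom n (Equiv.swap m (m + 1)) :=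
  fun i hi => Equiv.swap_apply_of_ne_of_ne (by omega) (by omega)

theorem FixesFrom.isFinitary {n : ℕ} {σ : Equiv.Perm ℕ} (hσ : FixesFrom n σ) : IsFinitary σ := by
  refine (Set.finite_Iio n).subset fun i hi => ?_
  by_contra h
  exact hi (hσ i (by simpa using h))

theorem IsFinitary.exists_fixesFrom {σ : Equiv.Perm ℕ} (hσ : IsFinitary σ) :
    ∃ n, FixesFrom n σ := by
  obtain ⟨n, hn⟩ := hσ.bddAbove
  refine ⟨n + 1, fun i hi => ?_⟩
  by_contra h
  have := hn h
  omega

theorem exists_mem_closure_swap_apply_eq (n : ℕ) : ∀ j ≤ n, ∃ d ∈ Submonoid.closure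
    {τ : Equiv.Perm ℕ | ∃ m < n, τ = Equiv.swap m (m + 1)}, d n = j := by
  induction n with
  | zero =>
    intro j hj
    exact ⟨1, one_mem _, by simp; omega⟩
  | succ n ih =>
    intro j hj
    rcases Nat.lt_or_ge n j with h | h
    · exact ⟨1, one_mem _, by simp; omega⟩
    · obtain ⟨d, hd, hdj⟩ := ih j h
      refine ⟨d * Equiv.swap n (n + 1), mul_mem ?_ (Submonoid.subset_closure ⟨n, by omega, rfl⟩),
        by simp [hdj]⟩
      refine Submonoid.closure_mono ?_ hd
      rintro τ ⟨m, hm, rfl⟩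
      exact ⟨m, by omega, rfl⟩

/-- Induction on n: a product d of adjacent transpositions with d n = σ n leaves d⁻¹σ fixing n as
well. -/
theorem FixesFrom.mem_closure_swap {n : ℕ} {σ : Equiv.Perm ℕ} (hσ : FixesFrom n σ) :
    σ ∈ Submonoid.closure {τ : Equiv.Perm ℕ | ∃ m, m + 1 < n ∧ τ = Equiv.swap m (m + 1)} := by
  induction n generalizing σ with
  | zero =>
    have : σ = 1 := Equiv.ext fun i => hσ i (Nat.zero_le i)
    rw [this]
    exact one_mem _
  | succ n ih =>
    have hlt := hσ.lt (Nat.lt_succ_self n)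
    obtain ⟨d, hd, hdn⟩ := exists_mem_closure_swap_apply_eq n (σ n) (by omega)
    have hd' : d ∈ Submonoid.closure
        {τ : Equiv.Perm ℕ | ∃ m, m + 1 < n + 1 ∧ τ = Equiv.swap m (m + 1)} := by
      simpa using hd
    have hfix : FixesFrom (n + 1) d := by
      refine Submonoid.closure_induction (motive := fun x _ => FixesFrom (n + 1) x) ?_ ?_ ?_ hd'
      · rintro τ ⟨m, hm, rfl⟩
        exact fixesFrom_swap hm
      · intro i _
        rfl
      · intro x y _ _ hx hy
        exact hx.mul hy
    have hrest : FixesFrom n (d⁻¹ * σ) := by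
      intro i hi
      rcases hi.eq_or_lt with rfl | hi
      · rw [Equiv.Perm.mul_apply, Equiv.Perm.inv_eq_iff_eq, hdn]
      · exact (hfix.inv.mul hσ) i hi
    have : σ = d * (d⁻¹ * σ) := by group
    rw [this]
    refine mul_mem hd' (Submonoid.closure_mono ?_ (ih hrest))
    rintro τ ⟨m, hm, rfl⟩
    exact ⟨m, by omega, rfl⟩

theorem permWord_congr {n : ℕ} {σ : Equiv.Perm ℕ} (hσ : FixesFrom n σ) {w w' : ℕ → α}
    (h : ∀ i < n, w i = w' i) : ∀ i < n, permWord σ w i = permWord σ w' i :=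
  fun _ hi => h _ (hσ.inv.lt hi)

theorem permWord_swap_left (m : ℕ) (w : ℕ → α) :
    permWord (Equiv.swap m (m + 1)) w m = w (m + 1) := by
  simp [permWord]

theorem permWord_swap_right (m : ℕ) (w : ℕ → α) :
    permWord (Equiv.swap m (m + 1)) w (m + 1) = w m := by
  simp [permWord]

theorem permWord_swap_of_ne {m i : ℕ} (w : ℕ → α) (h1 : i ≠ m) (h2 : i ≠ m + 1) :
    permWord (Equiv.swap m (m + 1)) w i = w i := by
  simp [permWord, Equiv.swap_apply_of_ne_of_ne h1 h2]

theorem measurable_permWord [MeasurableSpace α] (σ : Equiv.Perm ℕ) :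
    Measurable (permWord (α := α) σ) :=
  measurable_pi_lambda _ fun i => measurable_pi_apply (σ⁻¹ i)

end Permutations

/-! ### The inversion cocycle and its density -/

section Cocycle

variable {α : Type*} [LinearOrder α]

theorem cocycle_one (w : ℕ → α) : cocycle 1 w = 0 := by
  rw [cocycle_eq 1 w 0 fun _ _ => rfl, permWord_one, sub_self]

theorem cocycle_mul {n : ℕ} {σ τ : Equiv.Perm ℕ} (hσ : FixesFrom n σ) (hτ : FixesFrom n τ)
    (w : ℕ → α) : cocycle (σ * τ) w = cocycle σ (permWord τ w) + cocycle τ w := by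
  rw [cocycle_eq _ _ n (hσ.mul hτ), cocycle_eq _ _ n hσ, cocycle_eq _ _ n hτ, permWord_mul]
  ring

theorem invCount_congr {n : ℕ} {w w' : ℕ → α} (h : ∀ i < n, w i = w' i) :
    invCount n w = invCount n w' := by
  unfold invCount
  congr 1
  refine Finset.filter_congr fun p hp => ?_
  simp only [Finset.mem_product, Finset.mem_range] at hp
  rw [h _ hp.1, h _ hp.2]

theorem cocycle_congr {n : ℕ} {σ : Equiv.Perm ℕ} (hσ : FixesFrom n σ) {w w' : ℕ → α}
    (h : ∀ i < n, w i = w' i) : cocycle σ w = cocycle σ w' := by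
  rw [cocycle_eq _ _ n hσ, cocycle_eq _ _ n hσ, invCount_congr h,
    invCount_congr (permWord_congr hσ h)]

theorem card_filter_lt_succ (m : ℕ) (x : α) (w : ℕ → α) :
    ((Finset.range (m + 1)).filter (fun i => x < w i)).card =
      ((Finset.range m).filter (fun i => x < w i)).card + if x < w m then 1 else 0 := by
  rw [Finset.range_add_one, Finset.filter_insert]
  split_ifs <;> simp

theorem cocycle_swap (m : ℕ) (w : ℕ → α) :
    cocycle (Equiv.swap m (m + 1)) w =
      (if w m < w (m + 1) then 1 else 0) - (if w (m + 1) < w m then 1 else 0) := by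
  rw [cocycle_eq _ _ (m + 2) (fixesFrom_swap (by omega))]
  have h : ∀ i < m, permWord (Equiv.swap m (m + 1)) w i = w i := fun i hi =>
    permWord_swap_of_ne w (by omega) (by omega)
  have hc : ∀ x : α, ((Finset.range m).filter
      (fun i => x < permWord (Equiv.swap m (m + 1)) w i)) =
      (Finset.range m).filter (fun i => x < w i) := fun x =>
    Finset.filter_congr fun i hi => by rw [h i (Finset.mem_range.1 hi)]
  rw [invCount_succ, invCount_succ, invCount_succ, invCount_succ, card_filter_lt_succ,
    card_filter_lt_succ, permWord_swap_left, permWord_swap_right, hc, hc, invCount_congr h]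
  push_cast
  ring

end Cocycle

section Weight

variable {α : Type*} [LinearOrder α]

/-- The Radon-Nikodym derivative `q ^ cocycle σ w`. -/
noncomputable def weight (q : ℝ) (σ : Equiv.Perm ℕ) (w : ℕ → α) : ℝ≥0∞ :=
  ENNReal.ofReal (q ^ cocycle σ w)

theorem weight_ne_top (q : ℝ) (σ : Equiv.Perm ℕ) (w : ℕ → α) : weight q σ w ≠ ∞ :=
  ENNReal.ofReal_ne_top

theorem weight_ne_zero {q : ℝ} (h0 : 0 < q) (σ : Equiv.Perm ℕ) (w : ℕ → α) :
    weight q σ w ≠ 0 := by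
  simpa [weight] using zpow_pos h0 _

theorem weight_one (q : ℝ) (w : ℕ → α) : weight q 1 w = 1 := by
  simp [weight, cocycle_one]

theorem weight_mul {q : ℝ} (h0 : 0 < q) {n : ℕ} {σ τ : Equiv.Perm ℕ} (hσ : FixesFrom n σ)
    (hτ : FixesFrom n τ) (w : ℕ → α) :
    weight q (σ * τ) w = weight q σ (permWord τ w) * weight q τ w := by
  rw [weight, cocycle_mul hσ hτ, zpow_add₀ h0.ne', ENNReal.ofReal_mul (zpow_pos h0 _).le]
  rfl

variable [MeasurableSpace α]

variable [TopologicalSpace α] [SecondCountableTopology α] [OrderClosedTopology α]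
  [OpensMeasurableSpace α]

theorem measurable_invCount (n : ℕ) : Measurable (invCount (α := α) n) := by
  have : invCount (α := α) n = fun w => ∑ p ∈ Finset.range n ×ˢ Finset.range n,
      if p.1 < p.2 ∧ w p.2 < w p.1 then 1 else 0 := by
    funext w
    rw [invCount, Finset.card_filter]
  rw [this]
  refine Finset.measurable_sum _ fun p _ => Measurable.ite ?_ measurable_const measurable_const
  exact (MeasurableSet.const _).inter
    (measurableSet_lt (measurable_pi_apply _) (measurable_pi_apply _))

theorem measurable_weight (q : ℝ) {n : ℕ} {σ : Equiv.Perm ℕ} (hσ : FixesFrom n σ) :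
    Measurable (weight (α := α) q σ) := by
  have : weight (α := α) q σ = fun w => (fun p : ℕ × ℕ => ENNReal.ofReal (q ^ ((p.1 : ℤ) - p.2)))
      (invCount n (permWord σ w), invCount n w) := by
    funext w
    rw [weight, cocycle_eq _ _ n hσ]
  rw [this]
  exact (Measurable.of_discrete (f := fun p : ℕ × ℕ => ENNReal.ofReal (q ^ ((p.1 : ℤ) - p.2)))).comp
    (((measurable_invCount n).comp (measurable_permWord σ)).prodMk (measurable_invCount n))

end Weight

/-! ### q-exchangeability as a change-of-variables formula -/

section Invariance

variable {α : Type*} [LinearOrder α] [MeasurableSpace α]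

/-- The measure `P` transforms under `T_σ` with density `q ^ cocycle σ w`. -/
def IsQInvariant (q : ℝ) (P : Measure (ℕ → α)) (σ : Equiv.Perm ℕ) : Prop :=
  ∀ f : (ℕ → α) → ℝ≥0∞, Measurable f →
    ∫⁻ w, f w ∂P = ∫⁻ w, f (permWord σ w) * weight q σ w ∂P

theorem IsQInvariant.restrict {q : ℝ} {P : Measure (ℕ → α)} {σ : Equiv.Perm ℕ}
    (h : IsQInvariant q P σ) {E : Set (ℕ → α)} (hE : MeasurableSet E)
    (hEσ : ∀ w, permWord σ w ∈ E ↔ w ∈ E) (c : ℝ≥0∞) : IsQInvariant q (c • P.restrict E) σ := by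
  intro f hf
  rw [lintegral_smul_measure, lintegral_smul_measure, ← lintegral_indicator hE,
    ← lintegral_indicator hE, h _ (hf.indicator hE)]
  congr 1
  refine lintegral_congr fun w => ?_
  by_cases hw : w ∈ E
  · rw [Set.indicator_of_mem hw, Set.indicator_of_mem ((hEσ w).2 hw)]
  · rw [Set.indicator_of_notMem hw, Set.indicator_of_notMem (fun h => hw ((hEσ w).1 h)), zero_mul]

variable [TopologicalSpace α] [SecondCountableTopology α] [OrderClosedTopology α]
  [OpensMeasurableSpace α]

/-- The weights are multiplicative along the cocycle, so the formula passes to products, and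
adjacent transpositions generate. -/
theorem isQInvariant_of_swap {q : ℝ} (h0 : 0 < q) {P : Measure (ℕ → α)} {n : ℕ}
    (h : ∀ m, m + 1 < n → IsQInvariant q P (Equiv.swap m (m + 1))) {σ : Equiv.Perm ℕ}
    (hσ : FixesFrom n σ) : IsQInvariant q P σ := by
  have key : FixesFrom n σ ∧ IsQInvariant q P σ := by
    refine Submonoid.closure_induction (motive := fun x _ => FixesFrom n x ∧ IsQInvariant q P x)
      ?_ ?_ ?_ hσ.mem_closure_swap
    · rintro τ ⟨m, hm, rfl⟩
      exact ⟨fixesFrom_swap hm, h m hm⟩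
    · refine ⟨fun i _ => rfl, fun f hf => ?_⟩
      simp [permWord_one, weight_one]
    · rintro x y _ _ ⟨hx, hxP⟩ ⟨hy, hyP⟩
      refine ⟨hx.mul hy, fun f hf => ?_⟩
      rw [hxP f hf, hyP (fun w => f (permWord x w) * weight q x w)
        ((hf.comp (measurable_permWord x)).mul (measurable_weight q hx))]
      refine lintegral_congr fun w => ?_
      rw [permWord_mul, weight_mul h0 hx hy, mul_assoc]
  exact key.2

/-- The two absolute continuities come for free from the density, which is everywhere positive. -/
theorem isQExchangeable_iff {q : ℝ} (h0 : 0 < q) {P : Measure (ℕ → α)} :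
    IsQExchangeable q P ↔ ∀ n σ, FixesFrom n σ → IsQInvariant q P σ := by
  constructor
  · intro h n σ hσ f hf
    have hw := (h σ hσ.isFinitary).2.2
    have h1 : ∫⁻ w, f (permWord σ w) ∂(P.map (permWord σ⁻¹)) = ∫⁻ w, f w ∂P := by
      rw [lintegral_map (f := fun w => f (permWord σ w)) (hf.comp (measurable_permWord σ))
        (measurable_permWord _)]
      simp_rw [permWord_self_inv]
    have h2 := lintegral_withDensity_eq_lintegral_mul P (measurable_weight q hσ)
      (hf.comp (measurable_permWord σ))
    rw [← h1, hw]
    refine h2.trans ?_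
    refine lintegral_congr fun w => ?_
    rw [Pi.mul_apply, mul_comm]
    rfl
  · intro h σ hfin
    obtain ⟨n, hσ⟩ := hfin.exists_fixesFrom
    have hmw := measurable_weight (α := α) q hσ
    have heq : P.map (permWord σ⁻¹) = P.withDensity (weight q σ) := by
      ext X hX
      have hX' := measurable_permWord σ⁻¹ hX
      rw [Measure.map_apply (measurable_permWord _) hX, withDensity_apply _ hX,
        ← lintegral_indicator_one hX', h n σ hσ _ (measurable_one.indicator hX'),
        ← lintegral_indicator hX]
      refine lintegral_congr fun w => ?_
      by_cases hw : w ∈ X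
      · have : permWord σ w ∈ permWord σ⁻¹ ⁻¹' X := by
          rwa [Set.mem_preimage, permWord_inv_self]
        simp [Set.indicator_of_mem this, Set.indicator_of_mem hw]
      · have : permWord σ w ∉ permWord σ⁻¹ ⁻¹' X := by
          rwa [Set.mem_preimage, permWord_inv_self]
        simp [Set.indicator_of_notMem this, Set.indicator_of_notMem hw]
    refine ⟨?_, ?_, heq⟩
    · rw [heq]
      exact withDensity_absolutelyContinuous _ _
    · rw [heq]
      exact withDensity_absolutelyContinuous' hmw.aemeasurable
        (Eventually.of_forall fun w => weight_ne_zero h0 σ w)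

end Invariance

/-! ### Combinatorics of the shuffle -/

section Shuffle

variable {α β : Type*}

theorem remainder_comp (f : α → β) (v : ℕ → α) (ξ : ℕ → ℕ) (m : ℕ) :
    remainder (f ∘ v) ξ m = f ∘ remainder v ξ m := by
  induction m with
  | zero => rfl
  | succ m ih =>
    funext i
    simp only [remainder, ih, deleteAt, Function.comp_apply]
    split_ifs <;> rfl

/-- Choices act on positions, not on letters: the shuffle of `id` records which original position is
output at each step. -/
theorem shuffleWord_eq_comp (v : ℕ → α) (ξ : ℕ → ℕ) :
    shuffleWord v ξ = v ∘ shuffleWord id ξ := by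
  funext m
  simpa [shuffleWord] using congrFun (remainder_comp v id ξ m) (ξ m)

theorem remainder_congr_choices (v : ℕ → α) {ξ ξ' : ℕ → ℕ} {m : ℕ} (h : ∀ i < m, ξ i = ξ' i) :
    remainder v ξ m = remainder v ξ' m := by
  induction m with
  | zero => rfl
  | succ m ih =>
    rw [remainder, remainder, ih fun i hi => h i (by omega), h m (by omega)]

theorem monotone_deleteAt [Preorder α] {k : ℕ} {u : ℕ → α}
    (hu : ∀ i j, i ≤ j → j < k + 1 → u i ≤ u j) (p : ℕ) :
    ∀ i j, i ≤ j → j < k → deleteAt u p i ≤ deleteAt u p j := by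
  intro i j hij hj
  simp only [deleteAt]
  split_ifs
  · exact hu _ _ hij (by omega)
  · exact hu _ _ (by omega) (by omega)
  · omega
  · exact hu _ _ (by omega) (by omega)

theorem monotone_remainder [Preorder α] (ξ : ℕ → ℕ) {n : ℕ} {v : ℕ → α}
    (hv : ∀ i j, i ≤ j → j < n → v i ≤ v j) (m : ℕ) :
    ∀ i j, i ≤ j → j + m < n → remainder v ξ m i ≤ remainder v ξ m j := by
  induction m with
  | zero => exact hv
  | succ m ih =>
    intro i j hij hj
    exact monotone_deleteAt (k := n - m - 1) (fun i j hij hj => ih i j hij (by omega)) (ξ m) i j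
      hij (by omega)

theorem strictMono_remainder_id (ξ : ℕ → ℕ) (m : ℕ) : StrictMono (remainder id ξ m) := by
  induction m with
  | zero => exact strictMono_id
  | succ m ih =>
    intro i j hij
    simp only [remainder, deleteAt]
    split_ifs <;> exact ih (by omega)

theorem remainder_id_le (ξ : ℕ → ℕ) (m i : ℕ) : remainder id ξ m i ≤ i + m := by
  induction m generalizing i with
  | zero => exact le_rfl
  | succ m ih =>
    simp only [remainder, deleteAt]
    split_ifs
    · exact (ih i).trans (by omega)
    · exact (ih (i + 1)).trans (by omega)

theorem exists_remainder_id_eq_iff (ξ : ℕ → ℕ) (m j : ℕ) :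
    (∃ i, remainder id ξ m i = j) ↔ ∀ k < m, shuffleWord id ξ k ≠ j := by
  induction m with
  | zero => simp [remainder]
  | succ m ih =>
    have hinj := (strictMono_remainder_id ξ m).injective
    rw [Nat.forall_lt_succ_right, ← ih]
    constructor
    · rintro ⟨i, rfl⟩
      simp only [remainder, deleteAt, shuffleWord]
      split_ifs with h
      · exact ⟨⟨i, rfl⟩, fun he => by have := hinj he; omega⟩
      · exact ⟨⟨i + 1, rfl⟩, fun he => by have := hinj he; omega⟩
    · rintro ⟨⟨i, rfl⟩, hne⟩
      have hi : i ≠ ξ m := fun h => hne (by rw [shuffleWord, h])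
      rcases lt_or_gt_of_ne hi with h | h
      · exact ⟨i, by simp [remainder, deleteAt, h]⟩
      · refine ⟨i - 1, ?_⟩
        have h1 : ¬ i - 1 < ξ m := by omega
        have h2 : i - 1 + 1 = i := by omega
        simp [remainder, deleteAt, h1, h2]

theorem injective_shuffleWord_id (ξ : ℕ → ℕ) : Function.Injective (shuffleWord id ξ) := by
  have key : ∀ k m, k < m → shuffleWord id ξ k ≠ shuffleWord id ξ m := fun k m hkm =>
    (exists_remainder_id_eq_iff ξ m (shuffleWord id ξ m)).1 ⟨ξ m, rfl⟩ k hkm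
  intro a b hab
  by_contra hne
  rcases lt_or_gt_of_ne hne with h | h
  · exact key a b h hab
  · exact key b a h hab.symm

/-- Each choice 0 removes the leftmost remaining position, so the leftmost one tends to infinity and
passes every j. -/
theorem surjective_shuffleWord_id {ξ : ℕ → ℕ} (h : ∀ N, ∃ m, N ≤ m ∧ ξ m = 0) :
    Function.Surjective (shuffleWord id ξ) := by
  intro j
  by_contra hj
  push Not at hj
  have hmono : Monotone fun m => remainder id ξ m 0 := by
    refine monotone_nat_of_le_succ fun m => ?_
    simp only [remainder, deleteAt]
    split_ifs
    · exact le_rfl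
    · exact (strictMono_remainder_id ξ m).monotone (by omega)
  have hunb : ∀ K, ∃ m, K ≤ remainder id ξ m 0 := by
    intro K
    induction K with
    | zero => exact ⟨0, Nat.zero_le _⟩
    | succ K ih =>
      obtain ⟨m, hm⟩ := ih
      obtain ⟨m', hm', hz⟩ := h m
      refine ⟨m' + 1, (Nat.succ_le_succ (hm.trans (hmono hm'))).trans ?_⟩
      simp only [remainder, deleteAt, hz, lt_irrefl, if_false]
      exact strictMono_remainder_id ξ m' (by omega)
  obtain ⟨m, hm⟩ := hunb (j + 1)
  obtain ⟨i, hi⟩ := (exists_remainder_id_eq_iff ξ m j).2 fun k _ => hj k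
  have := (strictMono_remainder_id ξ m).monotone (Nat.zero_le i)
  omega

/-- Exchanging two successive choices so that the same two letters are chosen in the opposite
order. -/
def swapPair (p : ℕ × ℕ) : ℕ × ℕ :=
  if p.2 < p.1 then (p.2, p.1 - 1) else (p.2 + 1, p.1)

theorem swapPair_swapPair (p : ℕ × ℕ) : swapPair (swapPair p) = p := by
  obtain ⟨a, b⟩ := p
  unfold swapPair
  split_ifs with h1 h2 h2 <;> simp at h1 h2 ⊢ <;> omega

theorem deleteAt_swapPair (u : ℕ → α) (p : ℕ × ℕ) :
    deleteAt (deleteAt u (swapPair p).1) (swapPair p).2 = deleteAt (deleteAt u p.1) p.2 := by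
  obtain ⟨a, b⟩ := p
  funext i
  unfold swapPair deleteAt
  split_ifs <;> first | rfl | (simp only at *; omega)

theorem apply_swapPair_fst (u : ℕ → α) (p : ℕ × ℕ) :
    u (swapPair p).1 = deleteAt u p.1 p.2 := by
  unfold swapPair deleteAt
  split_ifs <;> rfl

/-- The effect on the sequence of choices of exchanging the letters number `m` and `m + 1` of the
shuffled word. -/
def swapChoices (m : ℕ) (ξ : ℕ → ℕ) : ℕ → ℕ :=
  fun i => if i = m then (swapPair (ξ m, ξ (m + 1))).1
    else if i = m + 1 then (swapPair (ξ m, ξ (m + 1))).2 else ξ i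

theorem swapChoices_left (m : ℕ) (ξ : ℕ → ℕ) :
    swapChoices m ξ m = (swapPair (ξ m, ξ (m + 1))).1 := by
  simp [swapChoices]

theorem swapChoices_right (m : ℕ) (ξ : ℕ → ℕ) :
    swapChoices m ξ (m + 1) = (swapPair (ξ m, ξ (m + 1))).2 := by
  simp [swapChoices]

theorem swapChoices_of_ne {m i : ℕ} (ξ : ℕ → ℕ) (h1 : i ≠ m) (h2 : i ≠ m + 1) :
    swapChoices m ξ i = ξ i := by
  simp [swapChoices, h1, h2]

theorem swapChoices_congr {m n : ℕ} (hm : m + 1 < n) {ξ ξ' : ℕ → ℕ} (h : ∀ i < n, ξ i = ξ' i) :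
    ∀ i < n, swapChoices m ξ i = swapChoices m ξ' i := by
  intro i hi
  simp only [swapChoices, h m (by omega), h (m + 1) hm, h i hi]

theorem swapChoices_swapChoices (m : ℕ) (ξ : ℕ → ℕ) :
    swapChoices m (swapChoices m ξ) = ξ := by
  funext i
  by_cases h1 : i = m
  · subst h1
    rw [swapChoices_left, swapChoices_left, swapChoices_right, Prod.mk.eta, swapPair_swapPair]
  by_cases h2 : i = m + 1
  · subst h2
    rw [swapChoices_right, swapChoices_left, swapChoices_right, Prod.mk.eta, swapPair_swapPair]
  rw [swapChoices_of_ne _ h1 h2, swapChoices_of_ne _ h1 h2]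

theorem measurable_swapChoices (m : ℕ) : Measurable (swapChoices m) := by
  refine measurable_pi_lambda _ fun i => ?_
  have hp : Measurable fun ξ : ℕ → ℕ => swapPair (ξ m, ξ (m + 1)) :=
    (Measurable.of_discrete (f := swapPair)).comp
      ((measurable_pi_apply m).prodMk (measurable_pi_apply (m + 1)))
  unfold swapChoices
  split_ifs
  · exact hp.fst
  · exact hp.snd
  · exact measurable_pi_apply i

theorem remainder_swapChoices (v : ℕ → α) (m k : ℕ) (ξ : ℕ → ℕ) :
    remainder v (swapChoices m ξ) (m + 2 + k) = remainder v ξ (m + 2 + k) := by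
  induction k with
  | zero =>
    have h : remainder v (swapChoices m ξ) m = remainder v ξ m :=
      remainder_congr_choices v fun i hi => swapChoices_of_ne ξ (by omega) (by omega)
    simp only [remainder, h, swapChoices_left, swapChoices_right]
    exact deleteAt_swapPair _ (ξ m, ξ (m + 1))
  | succ k ih =>
    rw [← Nat.add_assoc, remainder, remainder, ih, swapChoices_of_ne ξ (by omega) (by omega)]

/-- After the two modified steps the same two letters have been deleted, so the later steps are
unaffected. -/
theorem shuffleWord_swapChoices (v : ℕ → α) (m : ℕ) (ξ : ℕ → ℕ) :
    shuffleWord v (swapChoices m ξ) = permWord (Equiv.swap m (m + 1)) (shuffleWord v ξ) := by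
  have h : ∀ i ≤ m, remainder v (swapChoices m ξ) i = remainder v ξ i := fun i hi =>
    remainder_congr_choices v fun i hi => swapChoices_of_ne ξ (by omega) (by omega)
  have hleft : ∀ ξ : ℕ → ℕ, shuffleWord v (swapChoices m ξ) m = shuffleWord v ξ (m + 1) := by
    intro ξ
    have h : remainder v (swapChoices m ξ) m = remainder v ξ m :=
      remainder_congr_choices v fun i hi => swapChoices_of_ne ξ (by omega) (by omega)
    simp only [shuffleWord, remainder, h, swapChoices_left]
    exact apply_swapPair_fst _ (ξ m, ξ (m + 1))
  funext i
  rcases lt_trichotomy i m with hi | rfl | hi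
  · rw [permWord_swap_of_ne _ (by omega) (by omega), shuffleWord, shuffleWord, h i hi.le,
      swapChoices_of_ne ξ (by omega) (by omega)]
  · rw [permWord_swap_left, hleft]
  · rcases Nat.eq_or_lt_of_le hi with rfl | hi
    · rw [permWord_swap_right]
      have := hleft (swapChoices m ξ)
      rw [swapChoices_swapChoices] at this
      exact this.symm
    · obtain ⟨k, rfl⟩ := Nat.exists_eq_add_of_le (show m + 2 ≤ i by omega)
      rw [permWord_swap_of_ne _ (by omega) (by omega), shuffleWord, shuffleWord,
        remainder_swapChoices, swapChoices_of_ne ξ (by omega) (by omega)]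

theorem remainder_congr_word {v v' : ℕ → α} (ξ : ℕ → ℕ) (m i : ℕ) (h : ∀ j ≤ i + m, v j = v' j) :
    remainder v ξ m i = remainder v' ξ m i := by
  have h1 := congrFun (remainder_comp v id ξ m) i
  have h2 := congrFun (remainder_comp v' id ξ m) i
  simp only [Function.comp_id, Function.comp_apply] at h1 h2
  rw [h1, h2, h _ (remainder_id_le ξ m i)]

end Shuffle

/-! ### Quasi-invariance of the law of the choices -/

section ChoiceLaw

/-- The law of the sequence of independent geometric choices. -/
noncomputable abbrev choiceLaw (q : ℝ) (h0 : 0 < q) (h1 : q < 1) : Measure (ℕ → ℕ) :=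
  Measure.infinitePi fun _ : ℕ => geomLaw q h0 h1

/-- Every cylinder is also a cylinder over arbitrarily long initial segments. The threshold `N₀`
lets a proof assume that given coordinates are included. -/
theorem ext_of_map_restrict {β : Type*} [MeasurableSpace β] {P Q : Measure (ℕ → β)}
    [IsFiniteMeasure P] (N₀ : ℕ)
    (h : ∀ N, N₀ ≤ N → P.map ((Finset.range N).restrict (π := fun _ => β)) =
      Q.map ((Finset.range N).restrict (π := fun _ => β))) : P = Q := by
  have key : ∀ N, N₀ ≤ N → ∀ S : Set ((i : Finset.range N) → β), MeasurableSet S →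
      P ((Finset.range N).restrict (π := fun _ => β) ⁻¹' S) =
        Q ((Finset.range N).restrict (π := fun _ => β) ⁻¹' S) := by
    intro N hN S hS
    have hr : Measurable ((Finset.range N).restrict (π := fun _ => β)) :=
      Finset.measurable_restrict _
    rw [← Measure.map_apply hr hS, ← Measure.map_apply hr hS, h N hN]
  refine ext_of_generate_finite _ generateFrom_measurableCylinders.symm
    isPiSystem_measurableCylinders (fun C hC => ?_) ?_
  · obtain ⟨I, S, hS, rfl⟩ := (mem_measurableCylinders C).1 hC
    have hI : I ⊆ Finset.range (max N₀ (I.sup id + 1)) := by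
      intro i hi
      have : id i ≤ I.sup id := Finset.le_sup hi
      simp only [id] at this
      exact Finset.mem_range.2 (by omega)
    have hr : Measurable (Finset.restrict₂ (π := fun _ => β) hI) := Finset.measurable_restrict₂ hI
    exact key _ (le_max_left _ _) _ (hr hS)
  · simpa using key N₀ le_rfl Set.univ MeasurableSet.univ

variable {q : ℝ} (h0 : 0 < q) (h1 : q < 1)

theorem choiceLaw_cylinder (N : ℕ) (a : ℕ → ℕ) :
    choiceLaw q h0 h1 {ξ | ∀ i < N, ξ i = a i} =
      ∏ i ∈ Finset.range N, ENNReal.ofReal ((1 - q) * q ^ a i) := by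
  have : {ξ : ℕ → ℕ | ∀ i < N, ξ i = a i} =
      (↑(Finset.range N) : Set ℕ).pi fun i => {a i} := by
    ext ξ
    simp
  rw [this, Measure.infinitePi_pi _ fun _ _ => MeasurableSet.of_discrete]
  simp_rw [geomLaw_singleton]

/-- The density of `choiceLaw` under `swapChoices m`. -/
noncomputable def swapDensity (q : ℝ) (m : ℕ) (ξ : ℕ → ℕ) : ℝ≥0∞ :=
  if ξ (m + 1) < ξ m then ENNReal.ofReal q⁻¹ else ENNReal.ofReal q

theorem measurable_swapDensity (q : ℝ) (m : ℕ) : Measurable (swapDensity q m) :=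
  Measurable.ite (measurableSet_lt (measurable_pi_apply _) (measurable_pi_apply _))
    measurable_const measurable_const

include h0 h1 in
theorem swapDensity_swapChoices_mul (m : ℕ) (a : ℕ → ℕ) :
    swapDensity q m (swapChoices m a) *
      (ENNReal.ofReal ((1 - q) * q ^ swapChoices m a m) *
        ENNReal.ofReal ((1 - q) * q ^ swapChoices m a (m + 1))) =
      ENNReal.ofReal ((1 - q) * q ^ a m) * ENNReal.ofReal ((1 - q) * q ^ a (m + 1)) := by
  have hp : ∀ k : ℕ, 0 ≤ (1 - q) * q ^ k := fun k =>
    mul_nonneg (by linarith) (pow_pos h0 k).le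
  rw [swapDensity, swapChoices_left, swapChoices_right, ← ENNReal.ofReal_mul (hp _),
    ← ENNReal.ofReal_mul (hp _)]
  generalize a m = x
  generalize a (m + 1) = y
  by_cases h : y < x
  · have hs : swapPair (x, y) = (y, x - 1) := by simp [swapPair, h]
    rw [hs]
    simp only
    rw [if_neg (by omega), ← ENNReal.ofReal_mul h0.le]
    obtain ⟨z, rfl⟩ := Nat.exists_eq_add_of_lt h
    congr 1
    simp only [Nat.add_sub_cancel]
    ring
  · have hs : swapPair (x, y) = (y + 1, x) := by simp [swapPair, h]
    rw [hs]
    simp only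
    rw [if_pos (by omega), ← ENNReal.ofReal_mul (inv_pos.2 h0).le]
    congr 1
    field_simp
    ring

/-- On a cylinder fixing at least the first m + 2 choices the density is constant and only two
factors change; the sum of these two choices changes by exactly one. -/
theorem map_withDensity_swapChoices (m : ℕ) :
    choiceLaw q h0 h1 =
      ((choiceLaw q h0 h1).withDensity (swapDensity q m)).map (swapChoices m) := by
  refine ext_of_map_restrict (m + 2) fun N hN => Measure.ext_of_singleton fun x => ?_
  -- The padding 0 beyond N is immaterial: `swapChoices m` acts within the first N coordinates.
  set a : ℕ → ℕ := fun i => if h : i < N then x ⟨i, Finset.mem_range.2 h⟩ else 0 with ha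
  have hpre : (Finset.range N).restrict (π := fun _ => ℕ) ⁻¹' {x} = {ξ | ∀ i < N, ξ i = a i} := by
    ext ξ
    simp only [Set.mem_preimage, Set.mem_singleton_iff, funext_iff, Finset.restrict,
      Set.mem_ofPred_eq, Subtype.forall, Finset.mem_range]
    refine forall_congr' fun i => forall_congr' fun hi => ?_
    simp [ha, hi]
  have hmeas : ∀ b : ℕ → ℕ, MeasurableSet {ξ : ℕ → ℕ | ∀ i < N, ξ i = b i} := fun b => by
    simp only [Set.ofPred_forall]
    exact MeasurableSet.iInter fun i => MeasurableSet.iInter fun _ =>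
      measurableSet_eq_fun (measurable_pi_apply i) measurable_const
  have hsw : swapChoices m ⁻¹' {ξ | ∀ i < N, ξ i = a i} =
      {ξ | ∀ i < N, ξ i = swapChoices m a i} := by
    ext ξ
    constructor
    · intro h i hi
      rw [← swapChoices_congr (by omega) h i hi, swapChoices_swapChoices]
    · intro h i hi
      rw [swapChoices_congr (by omega) h i hi, swapChoices_swapChoices]
  rw [Measure.map_apply (Finset.measurable_restrict _) (MeasurableSet.singleton _),
    Measure.map_apply (Finset.measurable_restrict _) (MeasurableSet.singleton _), hpre,
    Measure.map_apply (measurable_swapChoices m) (hmeas a), hsw, withDensity_apply _ (hmeas _),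
    setLIntegral_congr_fun (g := fun _ => swapDensity q m (swapChoices m a)) (hmeas _)
      (fun ξ hξ => by
        simp only [Set.mem_ofPred_eq] at hξ
        simp only [swapDensity]
        rw [hξ m (by omega), hξ (m + 1) (by omega)]),
    setLIntegral_const, choiceLaw_cylinder, choiceLaw_cylinder]
  obtain ⟨k, rfl⟩ := Nat.exists_eq_add_of_le hN
  have split : ∀ f : ℕ → ℝ≥0∞, ∏ i ∈ Finset.range (m + 2 + k), f i =
      (∏ i ∈ Finset.range m, f i) * (f m * f (m + 1)) * ∏ i ∈ Finset.range k, f (m + 2 + i) := by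
    intro f
    rw [Finset.prod_range_add, Finset.prod_range_succ, Finset.prod_range_succ,
      mul_assoc (∏ i ∈ _, _)]
  rw [split, split]
  have e1 : ∏ i ∈ Finset.range m, ENNReal.ofReal ((1 - q) * q ^ swapChoices m a i) =
      ∏ i ∈ Finset.range m, ENNReal.ofReal ((1 - q) * q ^ a i) :=
    Finset.prod_congr rfl fun i hi => by
      have := Finset.mem_range.1 hi
      rw [swapChoices_of_ne a (by omega) (by omega)]
  have e2 : ∏ i ∈ Finset.range k, ENNReal.ofReal ((1 - q) * q ^ swapChoices m a (m + 2 + i)) =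
      ∏ i ∈ Finset.range k, ENNReal.ofReal ((1 - q) * q ^ a (m + 2 + i)) :=
    Finset.prod_congr rfl fun i hi => by
      rw [swapChoices_of_ne a (by omega) (by omega)]
  rw [e1, e2, ← swapDensity_swapChoices_mul h0 h1 m a]
  ring

theorem lintegral_choiceLaw_swap (m : ℕ) {g : (ℕ → ℕ) → ℝ≥0∞} (hg : Measurable g) :
    ∫⁻ ξ, g ξ ∂choiceLaw q h0 h1 =
      ∫⁻ ξ, g (swapChoices m ξ) * swapDensity q m ξ ∂choiceLaw q h0 h1 := by
  conv_lhs => rw [map_withDensity_swapChoices h0 h1 m]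
  rw [lintegral_map hg (measurable_swapChoices m)]
  refine (lintegral_withDensity_eq_lintegral_mul _ (measurable_swapDensity q m)
    (hg.comp (measurable_swapChoices m))).trans (lintegral_congr fun ξ => ?_)
  rw [Pi.mul_apply, mul_comm]
  rfl

end ChoiceLaw

/-! ### q-exchangeability of infinite and finite shuffles -/

section ShuffleInvariance

/-- Deletion shifts later positions down by one, so ξ m ≤ ξ (m + 1) means that the second letter
stood strictly to the right of the first. -/
theorem shuffleWord_order {α : Type*} [Preorder α] {n : ℕ} {v : ℕ → α}
    (hv : ∀ i j, i ≤ j → j < n → v i ≤ v j) {m : ℕ}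
    {ξ : ℕ → ℕ} (hm : ξ m + m < n) (hm' : ξ (m + 1) + (m + 1) < n) :
    (ξ (m + 1) < ξ m → shuffleWord v ξ (m + 1) ≤ shuffleWord v ξ m) ∧
      (ξ m ≤ ξ (m + 1) → shuffleWord v ξ m ≤ shuffleWord v ξ (m + 1)) := by
  have hmono := monotone_remainder ξ hv m
  constructor <;> intro h <;> simp only [shuffleWord, remainder, deleteAt]
  · rw [if_pos h]
    exact hmono _ _ h.le hm
  · rw [if_neg (by omega)]
    exact hmono _ _ (by omega) (by omega)

variable {α : Type*} [LinearOrder α] [MeasurableSpace α] [TopologicalSpace α]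
  [SecondCountableTopology α] [OrderClosedTopology α] [OpensMeasurableSpace α]
  {q : ℝ} (h0 : 0 < q) (h1 : q < 1)

/-- The event `B` covers two cases at once: all choices, and those keeping the shuffle inside a
prefix that may be the only sorted part of `v`. -/
theorem isQInvariant_swap_map_shuffleWord (v : ℕ → α) (m : ℕ) {B : Set (ℕ → ℕ)}
    (hBm : MeasurableSet B) (hB : ∀ ξ, swapChoices m ξ ∈ B ↔ ξ ∈ B)
    (hgt : ∀ ξ ∈ B, ξ (m + 1) < ξ m → shuffleWord v ξ (m + 1) ≤ shuffleWord v ξ m)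
    (hle : ∀ ξ ∈ B, ξ m ≤ ξ (m + 1) → shuffleWord v ξ m ≤ shuffleWord v ξ (m + 1)) :
    IsQInvariant q (((choiceLaw q h0 h1).restrict B).map (shuffleWord v))
      (Equiv.swap m (m + 1)) := by
  intro f hf
  have hW : Measurable (shuffleWord v) := measurable_shuffleWord v
  have hs := fixesFrom_swap (m := m) (n := m + 2) (by omega)
  set s := Equiv.swap m (m + 1) with hsdef
  set D : Set (ℕ → α) := {w | w m < w (m + 1)} ∪ {w | w (m + 1) < w m} with hD
  have hDm : MeasurableSet D :=
    (measurableSet_lt (measurable_pi_apply m) (measurable_pi_apply (m + 1))).union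
      (measurableSet_lt (measurable_pi_apply (m + 1)) (measurable_pi_apply m))
  have hgm : Measurable fun w : ℕ → α => f (permWord s w) * weight q s w :=
    (hf.comp (measurable_permWord s)).mul (measurable_weight q hs)
  -- Off `D` the two letters coincide, so the transposition does nothing and has weight 1, whereas
  -- `swapDensity` still depends on the choices. The involution is thus used only on `D`.
  rw [← lintegral_add_compl f hDm,
    ← lintegral_add_compl (fun w => f (permWord s w) * weight q s w) hDm]
  congr 1
  · have hEm : MeasurableSet (shuffleWord v ⁻¹' D ∩ B) := (hW hDm).inter hBm
    have hEinv : ∀ ξ, swapChoices m ξ ∈ shuffleWord v ⁻¹' D ∩ B ↔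
        ξ ∈ shuffleWord v ⁻¹' D ∩ B := by
      intro ξ
      refine and_congr ?_ (hB ξ)
      rw [Set.mem_preimage, Set.mem_preimage, shuffleWord_swapChoices, hD]
      change (_ < _ ∨ _ < _) ↔ (_ < _ ∨ _ < _)
      rw [permWord_swap_left, permWord_swap_right]
      exact or_comm
    rw [setLIntegral_map hDm hf hW, setLIntegral_map hDm hgm hW,
      Measure.restrict_restrict (hW hDm), ← lintegral_indicator hEm, ← lintegral_indicator hEm,
      lintegral_choiceLaw_swap h0 h1 m (g := (shuffleWord v ⁻¹' D ∩ B).indicator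
        fun ξ => f (shuffleWord v ξ)) ((hf.comp hW).indicator hEm)]
    refine lintegral_congr fun ξ => ?_
    by_cases hξ : ξ ∈ shuffleWord v ⁻¹' D ∩ B
    · rw [Set.indicator_of_mem hξ, Set.indicator_of_mem ((hEinv ξ).2 hξ),
        shuffleWord_swapChoices]
      congr 1
      have hne : shuffleWord v ξ m < shuffleWord v ξ (m + 1) ∨
        shuffleWord v ξ (m + 1) < shuffleWord v ξ m := hξ.1
      rw [swapDensity, weight, hsdef, cocycle_swap]
      by_cases h : ξ (m + 1) < ξ m
      · have hlt := hgt ξ hξ.2 h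
        rw [if_pos h, if_neg hlt.not_gt, if_pos (hne.resolve_left hlt.not_gt)]
        norm_num
      · have hlt := hle ξ hξ.2 (not_lt.1 h)
        rw [if_neg h, if_neg hlt.not_gt, if_pos (hne.resolve_right hlt.not_gt)]
        norm_num
    · rw [Set.indicator_of_notMem hξ, Set.indicator_of_notMem (fun h => hξ ((hEinv ξ).1 h)),
        zero_mul]
  · refine setLIntegral_congr_fun hDm.compl fun w hw => ?_
    have hle : ¬ w m < w (m + 1) := fun h => hw (Or.inl h)
    have hge : ¬ w (m + 1) < w m := fun h => hw (Or.inr h)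
    have heq : permWord s w = w := by
      funext i
      by_cases hi : i = m
      · rw [hi, permWord_swap_left]
        exact le_antisymm (not_lt.1 hle) (not_lt.1 hge)
      by_cases hi' : i = m + 1
      · rw [hi', permWord_swap_right]
        exact le_antisymm (not_lt.1 hge) (not_lt.1 hle)
      exact permWord_swap_of_ne w hi hi'
    rw [heq, weight, hsdef, cocycle_swap, if_neg hle, if_neg hge]
    simp

theorem isQExchangeable_shuffleLaw {v : ℕ → α} (hv : Monotone v) :
    IsQExchangeable q (shuffleLaw q h0 h1 v) := by
  rw [isQExchangeable_iff h0]
  intro n σ hσ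
  refine isQInvariant_of_swap h0 (fun m _ => ?_) hσ
  -- Since `v` is monotone everywhere, any n exceeding both ξ m + m and ξ (m + 1) + m + 1 serves.
  have := isQInvariant_swap_map_shuffleWord h0 h1 v m MeasurableSet.univ (fun _ => Iff.rfl)
    (fun ξ _ => (shuffleWord_order (n := ξ m + m + ξ (m + 1) + 2) (fun i j hij _ => hv hij)
      (by omega) (by omega)).1)
    (fun ξ _ => (shuffleWord_order (n := ξ m + m + ξ (m + 1) + 2) (fun i j hij _ => hv hij)
      (by omega) (by omega)).2)
  rwa [Measure.restrict_univ] at this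

/-- The choices for which the first `n` letters of the shuffled word are the first `n` letters of
the original word, in some order. -/
def prefixChoices (n : ℕ) : Set (ℕ → ℕ) :=
  {ξ | ∀ i < n, ξ i + i < n}

theorem measurableSet_prefixChoices (n : ℕ) : MeasurableSet (prefixChoices n) := by
  simp only [prefixChoices, Set.ofPred_forall]
  exact MeasurableSet.iInter fun i => MeasurableSet.iInter fun _ =>
    measurableSet_lt ((measurable_pi_apply i : Measurable fun ξ : ℕ → ℕ => ξ i).add_const i)
      measurable_const

theorem swapChoices_mem_prefixChoices {n m : ℕ} (hm : m + 1 < n) {ξ : ℕ → ℕ}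
    (hξ : ξ ∈ prefixChoices n) : swapChoices m ξ ∈ prefixChoices n := by
  have hp := hξ m (by omega)
  have hp' := hξ (m + 1) hm
  intro i hi
  by_cases h : i = m
  · subst h
    rw [swapChoices_left, swapPair]
    split_ifs <;> omega
  by_cases h' : i = m + 1
  · subst h'
    rw [swapChoices_right, swapPair]
    split_ifs <;> omega
  rw [swapChoices_of_ne _ h h']
  exact hξ i hi

/-- Restricting the choices to `prefixChoices n` models the finite q-shuffle of the first n letters,
up to normalization. -/
theorem isQInvariant_map_restrict_prefixChoices {n : ℕ} {v : ℕ → α}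
    (hv : ∀ i j, i ≤ j → j < n → v i ≤ v j) {σ : Equiv.Perm ℕ} (hσ : FixesFrom n σ) :
    IsQInvariant q (((choiceLaw q h0 h1).restrict (prefixChoices n)).map (shuffleWord v)) σ := by
  refine isQInvariant_of_swap h0 (fun m hm => ?_) hσ
  refine isQInvariant_swap_map_shuffleWord h0 h1 v m (measurableSet_prefixChoices n)
    (fun ξ => ⟨fun h => ?_, swapChoices_mem_prefixChoices hm⟩)
    (fun ξ hξ => (shuffleWord_order hv (hξ m (by omega)) (hξ (m + 1) hm)).1)
    (fun ξ hξ => (shuffleWord_order hv (hξ m (by omega)) (hξ (m + 1) hm)).2)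
  rw [← swapChoices_swapChoices m ξ]
  exact swapChoices_mem_prefixChoices hm h

end ShuffleInvariance

/-! ### Weighted averages over rearrangements of a prefix -/

section ExtendPerm

/-- The permutation of all positions extending a permutation of the first `n` positions. -/
def extendPerm {n : ℕ} (g : Equiv.Perm (Fin n)) : Equiv.Perm ℕ :=
  g.extendDomain Fin.equivSubtype

theorem extendPerm_mul {n : ℕ} (g h : Equiv.Perm (Fin n)) :
    extendPerm (g * h) = extendPerm g * extendPerm h :=
  (Equiv.Perm.extendDomain_mul _ g h).symm

theorem extendPerm_inv {n : ℕ} (g : Equiv.Perm (Fin n)) :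
    extendPerm g⁻¹ = (extendPerm g)⁻¹ :=
  (Equiv.Perm.extendDomain_inv g _).symm

theorem extendPerm_apply {n : ℕ} (g : Equiv.Perm (Fin n)) {i : ℕ} (hi : i < n) :
    extendPerm g i = g ⟨i, hi⟩ :=
  Equiv.Perm.extendDomain_apply_subtype g Fin.equivSubtype hi

theorem fixesFrom_extendPerm {n : ℕ} (g : Equiv.Perm (Fin n)) : FixesFrom n (extendPerm g) :=
  fun _ hi => Equiv.Perm.extendDomain_apply_not_subtype g Fin.equivSubtype (by omega)

theorem exists_shuffleWord_eq_permWord {α : Type*} {n : ℕ} (v : ℕ → α) {ξ : ℕ → ℕ}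
    (hξ : ξ ∈ prefixChoices n) : ∃ g : Equiv.Perm (Fin n), ∀ i < n,
      shuffleWord v ξ i = permWord (extendPerm g) v i := by
  have hlt : ∀ i < n, shuffleWord id ξ i < n := fun i hi =>
    (remainder_id_le ξ i (ξ i)).trans_lt (hξ i hi)
  set φ : Fin n → Fin n := fun i => ⟨shuffleWord id ξ i, hlt i i.2⟩ with hφ
  have hinj : Function.Injective φ := fun i j hij =>
    Fin.ext (injective_shuffleWord_id ξ (congrArg Fin.val hij))
  refine ⟨(Equiv.ofBijective φ (Finite.injective_iff_bijective.1 hinj))⁻¹, fun i hi => ?_⟩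
  rw [permWord, ← extendPerm_inv, inv_inv, extendPerm_apply _ hi, shuffleWord_eq_comp]
  rfl

end ExtendPerm

section Averaging

variable {α : Type*} [LinearOrder α]

/-- The sum of `f` over the rearrangements of the first `n` letters of `w`, with weights. -/
noncomputable def permSum (q : ℝ) (n : ℕ) (f : (ℕ → α) → ℝ≥0∞) (w : ℕ → α) : ℝ≥0∞ :=
  ∑ g : Equiv.Perm (Fin n), f (permWord (extendPerm g) w) * weight q (extendPerm g) w

/-- The weighted average of `f` over the rearrangements of the first `n` letters of `w`. -/
noncomputable def permAverage (q : ℝ) (n : ℕ) (f : (ℕ → α) → ℝ≥0∞) (w : ℕ → α) : ℝ≥0∞ :=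
  permSum q n f w / permSum q n (fun _ => 1) w

variable {q : ℝ} (h0 : 0 < q)

include h0 in
theorem permSum_one_ne_zero (n : ℕ) (w : ℕ → α) : permSum q n (fun _ => 1) w ≠ 0 := by
  intro h
  have := Finset.sum_eq_zero_iff.1 h 1 (Finset.mem_univ _)
  exact weight_ne_zero h0 _ _ (by simpa using this)

theorem permSum_one_ne_top (n : ℕ) (w : ℕ → α) : permSum q n (fun _ => 1) w ≠ ∞ :=
  ENNReal.sum_ne_top.2 fun g _ => by simpa using weight_ne_top q _ w

include h0 in
-- Reindex the sum by g ↦ gh. The weight factor does not depend on f, so it cancels in the quotient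
-- `permAverage`.
theorem permSum_permWord_mul {n : ℕ} (h : Equiv.Perm (Fin n)) (f : (ℕ → α) → ℝ≥0∞) (w : ℕ → α) :
    permSum q n f (permWord (extendPerm h) w) * weight q (extendPerm h) w = permSum q n f w := by
  rw [permSum, permSum, Finset.sum_mul]
  refine Eq.trans ?_ (Equiv.sum_comp (Equiv.mulRight h) _)
  refine Finset.sum_congr rfl fun g _ => ?_
  rw [Equiv.coe_mulRight, extendPerm_mul, permWord_mul,
    weight_mul h0 (fixesFrom_extendPerm g) (fixesFrom_extendPerm h), mul_assoc]

include h0 in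
theorem permAverage_permWord {n : ℕ} (h : Equiv.Perm (Fin n)) (f : (ℕ → α) → ℝ≥0∞) (w : ℕ → α) :
    permAverage q n f (permWord (extendPerm h) w) = permAverage q n f w := by
  rw [permAverage, permAverage, ← permSum_permWord_mul h0 h f w,
    ← permSum_permWord_mul h0 h (fun _ => 1) w,
    ENNReal.mul_div_mul_right _ _ (weight_ne_zero h0 _ w) (weight_ne_top q _ w)]

theorem permAverage_congr {n : ℕ} {f : (ℕ → α) → ℝ≥0∞}
    (hf : ∀ w w' : ℕ → α, (∀ i < n, w i = w' i) → f w = f w') {w w' : ℕ → α}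
    (h : ∀ i < n, w i = w' i) : permAverage q n f w = permAverage q n f w' := by
  have key : ∀ f : (ℕ → α) → ℝ≥0∞, (∀ w w' : ℕ → α, (∀ i < n, w i = w' i) → f w = f w') →
      permSum q n f w = permSum q n f w' := by
    intro f hf
    refine Finset.sum_congr rfl fun g _ => ?_
    rw [hf _ _ (permWord_congr (fixesFrom_extendPerm g) h), weight,
      cocycle_congr (fixesFrom_extendPerm g) h]
    rfl
  rw [permAverage, permAverage, key f hf, key _ fun _ _ _ => rfl]

theorem permAverage_le {n : ℕ} {f : (ℕ → α) → ℝ≥0∞} (hf : ∀ w, f w ≤ 1) (w : ℕ → α) :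
    permAverage q n f w ≤ 1 := by
  refine ENNReal.div_le_of_le_mul ?_
  rw [one_mul]
  exact Finset.sum_le_sum fun g _ => mul_le_mul_left (hf _) _

variable [MeasurableSpace α] [TopologicalSpace α]
  [SecondCountableTopology α] [OrderClosedTopology α] [OpensMeasurableSpace α]

theorem measurable_permSum {n : ℕ} {f : (ℕ → α) → ℝ≥0∞} (hf : Measurable f) :
    Measurable (permSum q n f) :=
  Finset.measurable_sum _ fun g _ => (hf.comp (measurable_permWord _)).mul
    (measurable_weight q (fixesFrom_extendPerm g))

theorem measurable_permAverage {n : ℕ} {f : (ℕ → α) → ℝ≥0∞} (hf : Measurable f) :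
    Measurable (permAverage q n f) :=
  (measurable_permSum hf).div (measurable_permSum measurable_const)

include h0 in
-- `permAverage` plays the role of a conditional expectation. Undoing each rearrangement by
-- invariance leaves f times coefficients that sum to 1.
theorem lintegral_permAverage {P : Measure (ℕ → α)} {n : ℕ}
    (hP : ∀ σ, FixesFrom n σ → IsQInvariant q P σ) {f : (ℕ → α) → ℝ≥0∞} (hf : Measurable f) :
    ∫⁻ w, permAverage q n f w ∂P = ∫⁻ w, f w ∂P := by
  set Z : (ℕ → α) → ℝ≥0∞ := permSum q n fun _ => 1 with hZ
  have hZm : Measurable Z := measurable_permSum measurable_const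
  have hG : ∀ g : Equiv.Perm (Fin n),
      Measurable fun w => f w / Z (permWord (extendPerm g)⁻¹ w) := fun g =>
    hf.div (hZm.comp (measurable_permWord _))
  calc ∫⁻ w, permAverage q n f w ∂P
      = ∫⁻ w, ∑ g : Equiv.Perm (Fin n), f (permWord (extendPerm g) w) /
          Z (permWord (extendPerm g)⁻¹ (permWord (extendPerm g) w)) *
            weight q (extendPerm g) w ∂P := by
        refine lintegral_congr fun w => ?_
        rw [permAverage, permSum, div_eq_mul_inv, Finset.sum_mul]
        refine Finset.sum_congr rfl fun g _ => ?_
        rw [permWord_inv_self, div_eq_mul_inv, mul_right_comm]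
    _ = ∑ g : Equiv.Perm (Fin n), ∫⁻ w, f w / Z (permWord (extendPerm g)⁻¹ w) ∂P := by
        rw [lintegral_finsetSum (f := fun (g : Equiv.Perm (Fin n)) w =>
          f (permWord (extendPerm g) w) / Z (permWord (extendPerm g)⁻¹ (permWord (extendPerm g) w)) *
            weight q (extendPerm g) w) _ fun g _ => ((hG g).comp (measurable_permWord _)).mul
          (measurable_weight q (fixesFrom_extendPerm g))]
        exact Finset.sum_congr rfl fun g _ => (hP _ (fixesFrom_extendPerm g) _ (hG g)).symm
    _ = ∫⁻ w, f w ∂P := by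
        rw [← lintegral_finsetSum _ fun g _ => hG g]
        refine lintegral_congr fun w => ?_
        -- The cocycle rule for the normalizer `Z` turns its value at the rearranged word into a
        -- weight over `Z w`; summed over g these give `Z w / Z w`.
        have hinv : ∀ g : Equiv.Perm (Fin n), (Z (permWord (extendPerm g)⁻¹ w))⁻¹ =
            weight q (extendPerm g⁻¹) w / Z w := by
          intro g
          have h := permSum_permWord_mul h0 g⁻¹ (fun _ => 1) w
          rw [← hZ] at h
          have h' := ENNReal.mul_div_mul_right 1 (Z (permWord (extendPerm g⁻¹) w))
            (weight_ne_zero h0 (extendPerm g⁻¹) w) (weight_ne_top q (extendPerm g⁻¹) w)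
          rw [one_mul, one_div, h] at h'
          rw [← extendPerm_inv, h']
        simp_rw [div_eq_mul_inv (f w), hinv, ← Finset.mul_sum, div_eq_mul_inv, ← Finset.sum_mul]
        have hsum : ∑ g : Equiv.Perm (Fin n), weight q (extendPerm g⁻¹) w = Z w := by
          rw [hZ, permSum, ← Equiv.sum_comp (Equiv.inv (Equiv.Perm (Fin n)))]
          simp
        rw [hsum, ENNReal.mul_inv_cancel (permSum_one_ne_zero h0 n w) (permSum_one_ne_top n w),
          mul_one]

/-- On `prefixChoices n` the output rearranges the first n letters of `v`, so the average of f is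
constant there, and averaging preserves the integral. -/
theorem setLIntegral_prefixChoices (h0 : 0 < q) (h1 : q < 1) {n : ℕ} {v : ℕ → α}
    (hv : ∀ i j, i ≤ j → j < n → v i ≤ v j) {f : (ℕ → α) → ℝ≥0∞} (hfm : Measurable f)
    (hf : ∀ w w' : ℕ → α, (∀ i < n, w i = w' i) → f w = f w') :
    ∫⁻ ξ in prefixChoices n, f (shuffleWord v ξ) ∂choiceLaw q h0 h1 =
      permAverage q n f v * choiceLaw q h0 h1 (prefixChoices n) := by
  have hW : Measurable (shuffleWord v) := measurable_shuffleWord v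
  rw [← lintegral_map hfm hW, ← lintegral_permAverage h0
      (fun σ hσ => isQInvariant_map_restrict_prefixChoices h0 h1 hv hσ) hfm,
    lintegral_map (measurable_permAverage hfm) hW,
    setLIntegral_congr_fun (g := fun _ => permAverage q n f v) (measurableSet_prefixChoices n),
    setLIntegral_const]
  intro ξ hξ
  obtain ⟨g, hg⟩ := exists_shuffleWord_eq_permWord v hξ
  simp only
  rw [permAverage_congr hf hg, permAverage_permWord h0]

end Averaging

/-! ### Order statistics and the sorted word -/

section Sorting

variable {α : Type*}

open Classical in
/-- The number of the first `n` letters of `w` that satisfy `p`. -/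
noncomputable def letterCount (p : α → Prop) (n : ℕ) (w : ℕ → α) : ℕ :=
  ((Finset.range n).filter fun i => p (w i)).card

open Classical in
theorem letterCount_succ (p : α → Prop) (n : ℕ) (w : ℕ → α) :
    letterCount p (n + 1) w = letterCount p n w + if p (w n) then 1 else 0 := by
  rw [letterCount, letterCount, Finset.range_add_one, Finset.filter_insert]
  split_ifs <;> simp

theorem letterCount_congr (p : α → Prop) {n : ℕ} {w w' : ℕ → α} (h : ∀ i < n, w i = w' i) :
    letterCount p n w = letterCount p n w' := by
  classical
  unfold letterCount
  congr 1
  exact Finset.filter_congr fun i hi => by rw [h i (Finset.mem_range.1 hi)]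

theorem monotone_letterCount (p : α → Prop) (w : ℕ → α) :
    Monotone fun n => letterCount p n w :=
  monotone_nat_of_le_succ fun n => by
    rw [letterCount_succ]
    exact Nat.le_add_right _ _

theorem letterCount_le_of_imp {p p' : α → Prop} (h : ∀ a, p a → p' a) (n : ℕ) (w : ℕ → α) :
    letterCount p n w ≤ letterCount p' n w := by
  classical
  exact Finset.card_le_card fun i hi => by
    rw [Finset.mem_filter] at hi ⊢
    exact ⟨hi.1, h _ hi.2⟩

theorem letterCount_add_not (p : α → Prop) (n : ℕ) (w : ℕ → α) :
    letterCount p n w + letterCount (fun a => ¬ p a) n w = n := by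
  classical
  unfold letterCount
  convert Finset.card_filter_add_card_filter_not (s := Finset.range n) fun i => p (w i)
  exact (Finset.card_range n).symm

theorem letterCount_permWord (p : α → Prop) {n : ℕ} {σ : Equiv.Perm ℕ} (hσ : FixesFrom n σ)
    (w : ℕ → α) : letterCount p n (permWord σ w) = letterCount p n w := by
  classical
  refine Finset.card_bij' (fun i _ => σ⁻¹ i) (fun i _ => σ i) ?_ ?_ ?_ ?_
  · intro i hi
    rw [Finset.mem_filter, Finset.mem_range] at hi ⊢
    exact ⟨hσ.inv.lt hi.1, hi.2⟩
  · intro i hi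
    rw [Finset.mem_filter, Finset.mem_range] at hi ⊢
    refine ⟨hσ.lt hi.1, ?_⟩
    rw [permWord, show σ⁻¹ (σ i) = i by simp]
    exact hi.2
  · intro i _
    simp
  · intro i _
    simp

theorem measurable_letterCount [MeasurableSpace α] {p : α → Prop} (hp : MeasurableSet {a | p a})
    (n : ℕ) : Measurable (letterCount p n) := by
  classical
  have : letterCount p n = fun w => ∑ i ∈ Finset.range n, if p (w i) then 1 else 0 := by
    funext w
    rw [letterCount, Finset.card_filter]
  rw [this]
  refine Finset.measurable_sum _ fun i _ => Measurable.ite ?_ measurable_const measurable_const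
  exact measurable_pi_apply i hp

theorem measurableSet_exists_lt_letterCount [MeasurableSpace α] {p : α → Prop}
    (hp : MeasurableSet {a | p a}) (j : ℕ) :
    MeasurableSet {w : ℕ → α | ∃ n, j < letterCount p n w} := by
  simp only [Set.ofPred_exists]
  exact MeasurableSet.iUnion fun n => measurableSet_lt measurable_const (measurable_letterCount hp n)

theorem exists_lt_letterCount_permWord (p : α → Prop) (j : ℕ) {n : ℕ} {σ : Equiv.Perm ℕ}
    (hσ : FixesFrom n σ) (w : ℕ → α) :
    (∃ k, j < letterCount p k (permWord σ w)) ↔ ∃ k, j < letterCount p k w := by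
  constructor <;> rintro ⟨k, hk⟩ <;> refine ⟨max n k, ?_⟩
  · rw [← letterCount_permWord p (hσ.mono (le_max_left n k))]
    exact hk.trans_le (monotone_letterCount p _ (le_max_right n k))
  · rw [letterCount_permWord p (hσ.mono (le_max_left n k))]
    exact hk.trans_le (monotone_letterCount p _ (le_max_right n k))

/-- The positions of `v` satisfying `p` form an initial segment, and a bijection preserves their
number. -/
theorem exists_lt_letterCount_comp_iff [Preorder α] {v : ℕ → α} (hv : Monotone v) {π : ℕ → ℕ}
    (hπ : Function.Bijective π) {p : α → Prop} (hp : ∀ a b, a ≤ b → p b → p a) (j : ℕ) :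
    (∃ n, j < letterCount p n (v ∘ π)) ↔ p (v j) := by
  classical
  constructor
  · rintro ⟨n, hn⟩
    by_contra hj
    have : letterCount p n (v ∘ π) ≤ (Finset.range j).card := by
      refine Finset.card_le_card_of_injOn π (fun i hi => ?_) hπ.1.injOn
      rw [Finset.mem_coe, Finset.mem_filter] at hi
      rw [Finset.mem_coe, Finset.mem_range]
      by_contra hij
      exact hj (hp _ _ (hv (not_lt.1 hij)) hi.2)
    rw [Finset.card_range] at this
    omega
  · intro hj
    set e := Equiv.ofBijective π hπ
    have he : ∀ l, π (e.symm l) = l := e.apply_symm_apply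
    -- By this time all of v_0, …, v_j have been output.
    refine ⟨(Finset.range (j + 1)).sup e.symm + 1, ?_⟩
    have : (Finset.range (j + 1)).card ≤
        letterCount p ((Finset.range (j + 1)).sup e.symm + 1) (v ∘ π) := by
      refine Finset.card_le_card_of_injOn e.symm (fun l hl => ?_) e.symm.injective.injOn
      have hle : e.symm l ≤ (Finset.range (j + 1)).sup e.symm := Finset.le_sup (f := e.symm) hl
      rw [Finset.mem_coe, Finset.mem_range] at hl
      rw [Finset.mem_coe, Finset.mem_filter, Finset.mem_range, Function.comp_apply, he]
      exact ⟨by omega, hp _ _ (hv (by omega)) hj⟩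
    rw [Finset.card_range] at this
    omega

variable [LinearOrder α]

/-- The word `w` with its first `n` letters sorted in increasing order. -/
noncomputable def sortPrefix (n : ℕ) (w : ℕ → α) : ℕ → α :=
  permWord (extendPerm (Tuple.sort fun i : Fin n => w i)⁻¹) w

theorem sortPrefix_apply {n i : ℕ} (w : ℕ → α) (hi : i < n) :
    sortPrefix n w i = w (Tuple.sort (fun i : Fin n => w i) ⟨i, hi⟩) := by
  rw [sortPrefix, permWord, ← extendPerm_inv, inv_inv, extendPerm_apply _ hi]

theorem monotone_sortPrefix (n : ℕ) (w : ℕ → α) :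
    ∀ i j, i ≤ j → j < n → sortPrefix n w i ≤ sortPrefix n w j := by
  intro i j hij hj
  rw [sortPrefix_apply w hj, sortPrefix_apply w (hij.trans_lt hj)]
  exact Tuple.monotone_sort (fun i : Fin n => w i) (a := ⟨i, hij.trans_lt hj⟩) (b := ⟨j, hj⟩) hij

theorem sortPrefix_iff {p : α → Prop} (hp : ∀ a b, a ≤ b → p b → p a) {n j : ℕ} (w : ℕ → α)
    (hj : j < n) : p (sortPrefix n w j) ↔ j < letterCount p n w := by
  classical
  have hmono := monotone_sortPrefix n w
  rw [← letterCount_permWord p (fixesFrom_extendPerm (Tuple.sort fun i : Fin n => w i)⁻¹) w]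
  change _ ↔ j < letterCount p n (sortPrefix n w)
  constructor
  · intro h
    have : (Finset.range (j + 1)).card ≤ letterCount p n (sortPrefix n w) := by
      refine Finset.card_le_card fun i hi => ?_
      rw [Finset.mem_range] at hi
      rw [Finset.mem_filter, Finset.mem_range]
      exact ⟨by omega, hp _ _ (hmono i j (by omega) hj) h⟩
    rw [Finset.card_range] at this
    omega
  · intro h
    by_contra hn
    have : letterCount p n (sortPrefix n w) ≤ (Finset.range j).card := by
      refine Finset.card_le_card fun i hi => ?_
      rw [Finset.mem_filter, Finset.mem_range] at hi
      rw [Finset.mem_range]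
      by_contra hij
      exact hn (hp _ _ (hmono j i (not_lt.1 hij) hi.1) hi.2)
    rw [Finset.card_range] at this
    omega

/-- The increasing word `v` lists the letters of `w` in increasing order: the successive order
statistics of the prefixes of `w` stabilize to the letters of `v`. -/
def SortsTo (w v : ℕ → α) : Prop :=
  Monotone v ∧ ∀ j, ∀ᶠ n in atTop, sortPrefix n w j = v j

theorem SortsTo.iff {w v : ℕ → α} (h : SortsTo w v) {p : α → Prop}
    (hp : ∀ a b, a ≤ b → p b → p a) (j : ℕ) : (∃ n, j < letterCount p n w) ↔ p (v j) := by
  constructor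
  · rintro ⟨k, hk⟩
    obtain ⟨n, hn, hkn, hjn⟩ :=
      ((h.2 j).and ((eventually_ge_atTop k).and (eventually_gt_atTop j))).exists
    rw [← hn, sortPrefix_iff hp w hjn]
    exact hk.trans_le (monotone_letterCount p w hkn)
  · intro hpv
    obtain ⟨n, hn, hjn⟩ := ((h.2 j).and (eventually_gt_atTop j)).exists
    rw [← hn, sortPrefix_iff hp w hjn] at hpv
    exact ⟨n, hpv⟩

/-- Appending a letter that is at least j + 1 of its predecessors does not change the order
statistic of index j. -/
theorem exists_sortsTo {w : ℕ → α} (h : ∀ k, ∀ᶠ n in atTop, k ≤ letterCount (· ≤ w n) n w) :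
    ∃ v, SortsTo w v := by
  have hstep : ∀ j, ∃ n₀, ∀ n, n₀ ≤ n → sortPrefix (n + 1) w j = sortPrefix n w j := by
    intro j
    obtain ⟨n₀, hn₀⟩ := eventually_atTop.1 ((h (j + 1)).and (eventually_gt_atTop j))
    refine ⟨n₀, fun n hn => ?_⟩
    obtain ⟨hc, hjn⟩ := hn₀ n hn
    have key : ∀ x, sortPrefix (n + 1) w j ≤ x ↔ sortPrefix n w j ≤ x := by
      intro x
      have hp : ∀ a b : α, a ≤ b → b ≤ x → a ≤ x := fun a b hab hb => hab.trans hb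
      rw [sortPrefix_iff (p := (· ≤ x)) hp w (by omega), sortPrefix_iff (p := (· ≤ x)) hp w hjn,
        letterCount_succ]
      split_ifs with hx
      · have := letterCount_le_of_imp (p := (· ≤ w n)) (p' := (· ≤ x))
          (fun a ha => ha.trans hx) n w
        omega
      · rfl
    exact le_antisymm ((key _).2 le_rfl) ((key _).1 le_rfl)
  choose n₀ hn₀ using hstep
  have hev : ∀ j, ∀ᶠ n in atTop, sortPrefix n w j = sortPrefix (n₀ j) w j := by
    intro j
    filter_upwards [eventually_ge_atTop (n₀ j)] with n hn
    induction n, hn using Nat.le_induction with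
    | base => rfl
    | succ n hn ih => rw [hn₀ j n hn, ih]
  refine ⟨fun j => sortPrefix (n₀ j) w j, fun i j hij => ?_, hev⟩
  obtain ⟨n, hi, hj, hjn⟩ := ((hev i).and ((hev j).and (eventually_gt_atTop j))).exists
  simp only
  rw [← hi, ← hj]
  exact monotone_sortPrefix n w i j hij hjn

/-- The cyclic permutation moving position `n` to the front. -/
def frontCycle : ℕ → Equiv.Perm ℕ
  | 0 => 1
  | n + 1 => frontCycle n * Equiv.swap n (n + 1)

theorem fixesFrom_frontCycle (n : ℕ) : FixesFrom (n + 1) (frontCycle n) := by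
  induction n with
  | zero => exact fun _ _ => rfl
  | succ n ih => exact (ih.mono (by omega)).mul (fixesFrom_swap (by omega))

theorem cocycle_frontCycle (n : ℕ) (w : ℕ → α) :
    cocycle (frontCycle n) w =
      (letterCount (· < w n) n w : ℤ) - letterCount (fun a => w n < a) n w := by
  classical
  induction n generalizing w with
  | zero => simp [frontCycle, cocycle_one, letterCount]
  | succ n ih =>
    have hc : ∀ p : α → Prop, letterCount p n (permWord (Equiv.swap n (n + 1)) w) =
        letterCount p n w := fun p =>
      letterCount_congr p fun i hi => permWord_swap_of_ne w (by omega) (by omega)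
    rw [frontCycle, cocycle_mul ((fixesFrom_frontCycle n).mono (show n + 1 ≤ n + 2 by omega))
      (fixesFrom_swap (by omega)), ih, hc, hc, permWord_swap_left, cocycle_swap,
      letterCount_succ, letterCount_succ]
    push_cast
    split_ifs <;> ring

end Sorting

/-! ### Almost sure existence of the sorted word -/

section AlmostSure

variable {α : Type*} [LinearOrder α] [MeasurableSpace α] [TopologicalSpace α]
  [SecondCountableTopology α] [OrderClosedTopology α] [OpensMeasurableSpace α]
  {q : ℝ}

/-- Markov's inequality for the density of `frontCycle n`, whose P-integral is 1. -/
theorem measure_letterCount_lt_le (h0 : 0 < q) (h1 : q < 1) {P : Measure (ℕ → α)}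
    [IsProbabilityMeasure P] (hP : IsQExchangeable q P) (k n : ℕ) :
    P {w | letterCount (· ≤ w n) n w < k} ≤
      ENNReal.ofReal (q ^ (-(2 * k : ℤ))) * ENNReal.ofReal (q ^ n) := by
  have hinv := (isQExchangeable_iff h0).1 hP (n + 1) _ (fixesFrom_frontCycle n) 1 measurable_one
  simp only [Pi.one_apply, lintegral_one, measure_univ, one_mul] at hinv
  -- On the event there are fewer than k smaller and more than n - k larger earlier letters, so the
  -- cocycle is below 2k - n.
  set ε : ℝ≥0∞ := ENNReal.ofReal (q ^ ((2 * k : ℤ) - n)) with hε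
  have hsub : {w : ℕ → α | letterCount (· ≤ w n) n w < k} ⊆
      {w | ε ≤ weight q (frontCycle n) w} := by
    intro w hw
    have hw' : letterCount (· ≤ w n) n w < k := hw
    refine ENNReal.ofReal_le_ofReal (zpow_le_zpow_right_of_le_one₀ h0 h1.le ?_)
    have e1 := letterCount_le_of_imp (p := (· < w n)) (p' := (· ≤ w n)) (fun a => le_of_lt) n w
    have e2 := letterCount_add_not (· ≤ w n) n w
    simp only [not_le] at e2
    rw [cocycle_frontCycle]
    omega
  have hle : ε * P {w | letterCount (· ≤ w n) n w < k} ≤ 1 := by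
    rw [hinv]
    exact (mul_le_mul_right (measure_mono hsub) ε).trans
      (mul_meas_ge_le_lintegral (measurable_weight q (fixesFrom_frontCycle n)) ε)
  have hε1 : ENNReal.ofReal (q ^ (-(2 * k : ℤ))) * ENNReal.ofReal (q ^ n) * ε = 1 := by
    rw [hε, ← ENNReal.ofReal_mul (zpow_pos h0 _).le, ← ENNReal.ofReal_mul (by positivity),
      ← zpow_natCast, ← zpow_add₀ h0.ne', ← zpow_add₀ h0.ne']
    ring_nf
    simp
  calc P {w | letterCount (· ≤ w n) n w < k}
      = ENNReal.ofReal (q ^ (-(2 * k : ℤ))) * ENNReal.ofReal (q ^ n) *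
          (ε * P {w | letterCount (· ≤ w n) n w < k}) := by rw [← mul_assoc, hε1, one_mul]
    _ ≤ _ := mul_le_of_le_one_right' hle

theorem ae_exists_sortsTo (h0 : 0 < q) (h1 : q < 1) {P : Measure (ℕ → α)}
    [IsProbabilityMeasure P] (hP : IsQExchangeable q P) : ∀ᵐ w ∂P, ∃ v, SortsTo w v := by
  have hk : ∀ k, ∀ᵐ w ∂P, ∀ᶠ n in atTop, k ≤ letterCount (· ≤ w n) n w := by
    intro k
    have hsum : ∑' n, P {w | letterCount (· ≤ w n) n w < k} ≠ ∞ := by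
      refine ne_top_of_le_ne_top ?_ (ENNReal.tsum_le_tsum (measure_letterCount_lt_le h0 h1 hP k))
      rw [ENNReal.tsum_mul_left]
      exact ENNReal.mul_ne_top ENNReal.ofReal_ne_top
        (summable_geometric_of_lt_one h0.le h1).tsum_ofReal_ne_top
    filter_upwards [ae_eventually_notMem hsum] with w hw
    filter_upwards [hw] with n hn
    exact not_lt.1 hn
  filter_upwards [ae_all_iff.2 hk] with w hw
  exact exists_sortsTo hw

/-- By independence, M consecutive choices avoid 0 with probability r ^ M, where r < 1. -/
theorem ae_choiceLaw_exists_eq_zero (h0 : 0 < q) (h1 : q < 1) :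
    ∀ᵐ ξ ∂choiceLaw q h0 h1, ∀ N, ∃ m, N ≤ m ∧ ξ m = 0 := by
  rw [ae_all_iff]
  intro N
  set r := geomLaw q h0 h1 {0}ᶜ with hr
  have hr1 : r < 1 := by
    rw [hr, prob_compl_eq_one_sub (MeasurableSet.singleton 0), geomLaw_singleton]
    refine ENNReal.sub_lt_self ENNReal.one_ne_top one_ne_zero ?_
    simpa using h1
  have hle : ∀ M : ℕ, choiceLaw q h0 h1 {ξ | ¬ ∃ m, N ≤ m ∧ ξ m = 0} ≤ r ^ M := by
    intro M
    have hpi := Measure.infinitePi_pi (fun _ : ℕ => geomLaw q h0 h1)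
      (s := Finset.Ico N (N + M)) (t := fun _ => {0}ᶜ) fun _ _ => MeasurableSet.of_discrete
    rw [Finset.prod_const, Nat.card_Ico, Nat.add_sub_cancel_left] at hpi
    rw [← hpi]
    refine measure_mono fun ξ hξ i hi => ?_
    rw [Finset.mem_coe, Finset.mem_Ico] at hi
    exact fun h => hξ ⟨i, hi.1, h⟩
  exact le_antisymm (ge_of_tendsto'
    (ENNReal.tendsto_pow_atTop_nhds_zero_of_lt_one hr1) hle) zero_le

end AlmostSure

/-! ### Real letters: rational thresholds determine the sorted word -/

section RealLetters

variable {A : Set ℝ} {q : ℝ}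

theorem measurableSet_coe_le (x : ℝ) : MeasurableSet {a : A | (a : ℝ) ≤ x} :=
  measurableSet_le measurable_subtype_coe measurable_const

/-- Identifies the sorted word through countably many measurable events, invariant under finitary
permutations; no measurability of w ↦ v is needed. -/
theorem SortsTo.eq_of_forall_rat {w v v' : ℕ → A} (h : SortsTo w v)
    (h' : ∀ (x : ℚ) (j : ℕ),
      (∃ n, j < letterCount (fun a : A => (a : ℝ) ≤ x) n w) ↔ (v' j : ℝ) ≤ x) : v = v' := by
  have key : ∀ (x : ℚ) (j : ℕ), (v j : ℝ) ≤ x ↔ (v' j : ℝ) ≤ x := fun x j => by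
    rw [← h' x j, h.iff (p := fun a : A => (a : ℝ) ≤ x)
      (fun a b hab hb => le_trans (Subtype.coe_le_coe.2 hab) hb) j]
  funext j
  refine Subtype.ext (le_antisymm ?_ ?_)
  · exact le_of_forall_lt_rat_imp_le fun x hx => (key x j).2 hx.le
  · exact le_of_forall_lt_rat_imp_le fun x hx => (key x j).1 hx.le

/-- Almost surely the output is `v` composed with a bijection, which fixes all threshold events. A
sorted word exists by exchangeability, and the thresholds force it to be `v`. -/
theorem ae_shuffleLaw_sortsTo (h0 : 0 < q) (h1 : q < 1) {v : ℕ → A} (hv : Monotone v) :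
    ∀ᵐ w ∂shuffleLaw q h0 h1 v, SortsTo w v := by
  have := isProbabilityMeasure_shuffleLaw q h0 h1 v
  have hev : ∀ᵐ w ∂shuffleLaw q h0 h1 v, ∀ (x : ℚ) (j : ℕ),
      (∃ n, j < letterCount (fun a : A => (a : ℝ) ≤ x) n w) ↔ (v j : ℝ) ≤ x := by
    rw [ae_all_iff]
    intro x
    rw [ae_all_iff]
    intro j
    have hE := measurableSet_exists_lt_letterCount (measurableSet_coe_le (A := A) (x : ℝ)) j
    rw [shuffleLaw, ae_map_iff (measurable_shuffleWord v).aemeasurable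
      (hE.iff (MeasurableSet.const _))]
    filter_upwards [ae_choiceLaw_exists_eq_zero h0 h1] with ξ hξ
    rw [shuffleWord_eq_comp]
    exact exists_lt_letterCount_comp_iff hv
      ⟨injective_shuffleWord_id ξ, surjective_shuffleWord_id hξ⟩
      (p := fun a : A => (a : ℝ) ≤ x)
      (fun a b hab hb => le_trans (Subtype.coe_le_coe.2 hab) hb) j
  filter_upwards [hev, ae_exists_sortsTo h0 h1 (isQExchangeable_shuffleLaw h0 h1 hv)] with w hw hs
  obtain ⟨v', hv'⟩ := hs
  rwa [hv'.eq_of_forall_rat hw] at hv'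

end RealLetters

/-! ### Convergence of finite shuffles, uniqueness and extremality -/

section Uniqueness

variable {q : ℝ} (h0 : 0 < q) (h1 : q < 1)

theorem choiceLaw_inter_eq_mul {m n : ℕ} {X Y : Set (ℕ → ℕ)}
    (hX : ∀ ξ ξ' : ℕ → ℕ, (∀ i < m, ξ i = ξ' i) → ξ ∈ X → ξ' ∈ X)
    (hY : ∀ ξ ξ' : ℕ → ℕ, (∀ i, m ≤ i → i < n → ξ i = ξ' i) → ξ ∈ Y → ξ' ∈ Y) :
    choiceLaw q h0 h1 (X ∩ Y) = choiceLaw q h0 h1 X * choiceLaw q h0 h1 Y := by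
  have hdisj : Disjoint (Finset.range m) (Finset.Ico m n) := by
    rw [Finset.disjoint_left]
    intro i hi hi'
    rw [Finset.mem_range] at hi
    rw [Finset.mem_Ico] at hi'
    omega
  have hind := (iIndepFun_infinitePi (P := fun _ : ℕ => geomLaw q h0 h1) (X := fun _ k => k)
    fun _ => measurable_id).indepFun_finset _ _ hdisj fun i => measurable_pi_apply i
  -- `X` and `Y` are recovered from their images in countable spaces, where every set is measurable.
  have key := hind.measure_inter_preimage_eq_mul
    ((fun (ξ : ℕ → ℕ) (i : Finset.range m) => ξ i) '' X)
    ((fun (ξ : ℕ → ℕ) (i : Finset.Ico m n) => ξ i) '' Y)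
    (Set.to_countable _).measurableSet (Set.to_countable _).measurableSet
  have eX : (fun (ξ : ℕ → ℕ) (i : Finset.range m) => ξ i) ⁻¹'
      ((fun (ξ : ℕ → ℕ) (i : Finset.range m) => ξ i) '' X) = X := by
    refine Set.Subset.antisymm ?_ (Set.subset_preimage_image _ _)
    rintro ξ ⟨ξ', hξ', he⟩
    exact hX ξ' ξ (fun i hi => congrFun he ⟨i, Finset.mem_range.2 hi⟩) hξ'
  have eY : (fun (ξ : ℕ → ℕ) (i : Finset.Ico m n) => ξ i) ⁻¹'
      ((fun (ξ : ℕ → ℕ) (i : Finset.Ico m n) => ξ i) '' Y) = Y := by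
    refine Set.Subset.antisymm ?_ (Set.subset_preimage_image _ _)
    rintro ξ ⟨ξ', hξ', he⟩
    exact hY ξ' ξ (fun i hi hi' => congrFun he ⟨i, Finset.mem_Ico.2 ⟨hi, hi'⟩⟩) hξ'
  rw [eX, eY] at key
  exact key

theorem choiceLaw_prefixChoices_ne_zero (n : ℕ) : choiceLaw q h0 h1 (prefixChoices n) ≠ 0 := by
  have hsub : {ξ : ℕ → ℕ | ∀ i < n, ξ i = (fun _ => 0 : ℕ → ℕ) i} ⊆ prefixChoices n := by
    intro ξ hξ i hi
    have : ξ i = 0 := hξ i hi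
    omega
  refine (lt_of_lt_of_le ?_ (measure_mono hsub)).ne'
  rw [choiceLaw_cylinder, pos_iff_ne_zero, Finset.prod_ne_zero_iff]
  intro i _
  simpa using h1

variable {α : Type*} [LinearOrder α] [MeasurableSpace α] [TopologicalSpace α]
  [SecondCountableTopology α] [OrderClosedTopology α] [OpensMeasurableSpace α]

/-- The average is the probability of `C` given `prefixChoices n`. As `C` depends on the first m
choices only, the constraint on the later ones is independent and cancels, leaving a conditioning
event whose probability tends to 1 as n grows. -/
theorem permAverage_eq_div {m n : ℕ} (hmn : m ≤ n) {v : ℕ → α}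
    (hv : ∀ i j, i ≤ j → j < n → v i ≤ v j) {C : Set (ℕ → α)} (hC : MeasurableSet C)
    (hCm : ∀ w w' : ℕ → α, (∀ i < m, w i = w' i) → w ∈ C → w' ∈ C) :
    permAverage q n (C.indicator 1) v =
      choiceLaw q h0 h1 ({ξ | ∀ i < m, ξ i + i < n} ∩ shuffleWord v ⁻¹' C) /
        choiceLaw q h0 h1 {ξ | ∀ i < m, ξ i + i < n} := by
  set X : Set (ℕ → ℕ) := {ξ | ∀ i < m, ξ i + i < n} with hX
  set Y : Set (ℕ → ℕ) := {ξ | ∀ i, m ≤ i → i < n → ξ i + i < n} with hY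
  have hXY : prefixChoices n = X ∩ Y := by
    ext ξ
    constructor
    · exact fun h => ⟨fun i hi => h i (hi.trans_le hmn), fun i _ hi => h i hi⟩
    · rintro ⟨hx, hy⟩ i hi
      rcases lt_or_ge i m with h | h
      · exact hx i h
      · exact hy i h hi
  have hf : ∀ w w' : ℕ → α, (∀ i < n, w i = w' i) →
      C.indicator (1 : (ℕ → α) → ℝ≥0∞) w = C.indicator 1 w' := by
    intro w w' h
    have hiff : w ∈ C ↔ w' ∈ C := ⟨hCm w w' fun i hi => h i (hi.trans_le hmn),
      hCm w' w fun i hi => (h i (hi.trans_le hmn)).symm⟩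
    by_cases hw : w ∈ C
    · rw [Set.indicator_of_mem hw, Set.indicator_of_mem (hiff.1 hw)]
      rfl
    · rw [Set.indicator_of_notMem hw, Set.indicator_of_notMem fun h => hw (hiff.2 h)]
  have key := setLIntegral_prefixChoices h0 h1 hv (measurable_one.indicator hC) hf
  have hlhs : ∫⁻ ξ in prefixChoices n, C.indicator 1 (shuffleWord v ξ) ∂choiceLaw q h0 h1 =
      choiceLaw q h0 h1 (shuffleWord v ⁻¹' C ∩ prefixChoices n) := by
    rw [← Measure.restrict_apply (measurable_shuffleWord v hC),
      ← lintegral_indicator_one (measurable_shuffleWord v hC)]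
    rfl
  have hXc : ∀ ξ ξ' : ℕ → ℕ, (∀ i < m, ξ i = ξ' i) → ξ ∈ X → ξ' ∈ X := by
    intro ξ ξ' h hξ i hi
    rw [← h i hi]
    exact hξ i hi
  have hYc : ∀ ξ ξ' : ℕ → ℕ, (∀ i, m ≤ i → i < n → ξ i = ξ' i) → ξ ∈ Y → ξ' ∈ Y := by
    intro ξ ξ' h hξ i hi hi'
    rw [← h i hi hi']
    exact hξ i hi hi'
  have hCc : ∀ ξ ξ' : ℕ → ℕ, (∀ i < m, ξ i = ξ' i) → ξ ∈ X ∩ shuffleWord v ⁻¹' C →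
      ξ' ∈ X ∩ shuffleWord v ⁻¹' C := by
    rintro ξ ξ' h ⟨hξ, hξC⟩
    refine ⟨hXc ξ ξ' h hξ, hCm _ _ (fun i hi => ?_) hξC⟩
    rw [shuffleWord, shuffleWord, h i hi,
      remainder_congr_choices v fun k hk => h k (hk.trans hi)]
  have hne : choiceLaw q h0 h1 X * choiceLaw q h0 h1 Y ≠ 0 := by
    rw [← choiceLaw_inter_eq_mul h0 h1 hXc hYc, ← hXY]
    exact choiceLaw_prefixChoices_ne_zero h0 h1 n
  rw [hlhs, Set.inter_comm, hXY, Set.inter_right_comm, choiceLaw_inter_eq_mul h0 h1 hCc hYc,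
    choiceLaw_inter_eq_mul h0 h1 hXc hYc, ← mul_assoc] at key
  have hcancel := (ENNReal.mul_left_inj (right_ne_zero_of_mul hne) (measure_ne_top _ _)).1 key
  rw [hcancel, ENNReal.mul_div_cancel_right (left_ne_zero_of_mul hne) (measure_ne_top _ _)]

/-- The average at `w` equals that at its sorted prefix. For fixed ξ the first m output letters read
finitely many positions, where the sorted prefixes eventually agree with `v`; dominated convergence
does the rest. -/
theorem tendsto_permAverage {w v : ℕ → α} (hwv : SortsTo w v) {m : ℕ} {C : Set (ℕ → α)}
    (hC : MeasurableSet C) (hCm : ∀ w w' : ℕ → α, (∀ i < m, w i = w' i) → w ∈ C → w' ∈ C) :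
    Tendsto (fun n => permAverage q n (C.indicator 1) w) atTop
      (nhds (shuffleLaw q h0 h1 v C)) := by
  have hXm : ∀ n, MeasurableSet {ξ : ℕ → ℕ | ∀ i < m, ξ i + i < n} := fun n => by
    simp only [Set.ofPred_forall]
    exact MeasurableSet.iInter fun i => MeasurableSet.iInter fun _ =>
      measurableSet_lt ((measurable_pi_apply i : Measurable fun ξ : ℕ → ℕ => ξ i).add_const i)
        measurable_const
  have hXe : ∀ ξ : ℕ → ℕ, ∀ᶠ n in atTop, ∀ i < m, ξ i + i < n := fun ξ =>
    (Set.finite_Iio m).eventually_all.2 fun i _ => eventually_gt_atTop (ξ i + i)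
  have hden : Tendsto (fun n => choiceLaw q h0 h1 {ξ | ∀ i < m, ξ i + i < n}) atTop (nhds 1) := by
    rw [← measure_univ (μ := choiceLaw q h0 h1)]
    refine tendsto_measure_of_tendsto_indicator atTop hXm MeasurableSet.univ
      (measure_ne_top _ _) (Eventually.of_forall fun n => Set.subset_univ _) fun ξ => ?_
    filter_upwards [hXe ξ] with n hn
    exact ⟨fun _ => trivial, fun _ => hn⟩
  have hnum : Tendsto (fun n => choiceLaw q h0 h1 ({ξ | ∀ i < m, ξ i + i < n} ∩
      shuffleWord (sortPrefix n w) ⁻¹' C)) atTop (nhds (shuffleLaw q h0 h1 v C)) := by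
    rw [shuffleLaw, Measure.map_apply (measurable_shuffleWord v) hC]
    refine tendsto_measure_of_tendsto_indicator atTop
      (fun n => (hXm n).inter (measurable_shuffleWord _ hC)) MeasurableSet.univ
      (measure_ne_top _ _) (Eventually.of_forall fun n => Set.subset_univ _) fun ξ => ?_
    have hagree : ∀ᶠ n in atTop, ∀ i < m, ∀ j ≤ ξ i + i, sortPrefix n w j = v j :=
      (Set.finite_Iio m).eventually_all.2 fun i _ =>
        (Set.finite_Iic (ξ i + i)).eventually_all.2 fun j _ => hwv.2 j
    filter_upwards [hXe ξ, hagree] with n hn hn'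
    have hsh : ∀ i < m, shuffleWord (sortPrefix n w) ξ i = shuffleWord v ξ i := fun i hi =>
      remainder_congr_word ξ i (ξ i) (hn' i hi)
    exact ⟨fun h => hCm _ _ hsh h.2, fun h => ⟨hn, hCm _ _ (fun i hi => (hsh i hi).symm) h⟩⟩
  have hdiv := ENNReal.Tendsto.div hnum (Or.inr one_ne_zero) hden (Or.inl ENNReal.one_ne_top)
  rw [div_one] at hdiv
  refine hdiv.congr' ?_
  filter_upwards [eventually_ge_atTop m] with n hn
  rw [← permAverage_eq_div h0 h1 hn (monotone_sortPrefix n w) hC hCm, sortPrefix,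
    permAverage_permWord h0]

theorem eq_shuffleLaw_of_ae_sortsTo {P : Measure (ℕ → α)} [IsProbabilityMeasure P]
    (hP : IsQExchangeable q P) {v : ℕ → α} (hv : ∀ᵐ w ∂P, SortsTo w v) :
    P = shuffleLaw q h0 h1 v := by
  refine ext_of_map_restrict 0 fun m _ => ?_
  have hr : Measurable ((Finset.range m).restrict (π := fun _ => α)) :=
    Finset.measurable_restrict _
  ext S hS
  rw [Measure.map_apply hr hS, Measure.map_apply hr hS]
  set C := (Finset.range m).restrict (π := fun _ => α) ⁻¹' S with hCdef
  have hC : MeasurableSet C := hr hS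
  have hCm : ∀ w w' : ℕ → α, (∀ i < m, w i = w' i) → w ∈ C → w' ∈ C := by
    intro w w' h hw
    have : (Finset.range m).restrict (π := fun _ => α) w' =
        (Finset.range m).restrict (π := fun _ => α) w :=
      funext fun i => (h i (Finset.mem_range.1 i.2)).symm
    rw [hCdef, Set.mem_preimage, this]
    exact hw
  have hfm : Measurable (C.indicator (1 : (ℕ → α) → ℝ≥0∞)) := measurable_one.indicator hC
  have hlim : Tendsto (fun n => ∫⁻ w, permAverage q n (C.indicator 1) w ∂P) atTop
      (nhds (∫⁻ _, shuffleLaw q h0 h1 v C ∂P)) := by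
    refine tendsto_lintegral_of_dominated_convergence 1 (fun n => measurable_permAverage hfm)
      (fun n => Eventually.of_forall fun w => permAverage_le (fun w => ?_) w) (by simp) ?_
    · exact Set.indicator_le_self' (fun _ _ => zero_le) w
    · filter_upwards [hv] with w hw
      exact tendsto_permAverage h0 h1 hw hC hCm
  have hconst : ∀ n, ∫⁻ w, permAverage q n (C.indicator 1) w ∂P = P C := fun n => by
    rw [lintegral_permAverage h0 ((isQExchangeable_iff h0).1 hP n) hfm,
      lintegral_indicator_one hC]
  simp only [hconst, lintegral_const, measure_univ, mul_one] at hlim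
  exact tendsto_nhds_unique tendsto_const_nhds hlim

include h0 in
theorem isQExchangeable_cond {P : Measure (ℕ → α)} (hP : IsQExchangeable q P)
    {E : Set (ℕ → α)} (hE : MeasurableSet E)
    (hinv : ∀ n σ, FixesFrom n σ → ∀ w, permWord σ w ∈ E ↔ w ∈ E) {c : ℝ≥0∞} :
    IsQExchangeable q (c • P.restrict E) := by
  rw [isQExchangeable_iff h0] at hP ⊢
  exact fun n σ hσ => (hP n σ hσ).restrict hE (hinv n σ hσ) c

include h0 in
-- Otherwise `P` would be a proper mixture of its conditionings on `E` and on the complement, both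
-- q-exchangeable and distinct from `P`.
theorem ae_mem_or_ae_notMem_of_mem_extremePoints {P : Measure (ℕ → α)}
    (hP : P ∈ Set.extremePoints ℝ≥0 (qExchangeableMeasures α q)) {E : Set (ℕ → α)}
    (hE : MeasurableSet E) (hinv : ∀ n σ, FixesFrom n σ → ∀ w, permWord σ w ∈ E ↔ w ∈ E) :
    (∀ᵐ w ∂P, w ∈ E) ∨ ∀ᵐ w ∂P, w ∉ E := by
  obtain ⟨⟨hprob, hexch⟩, hext⟩ := mem_extremePoints.1 hP
  by_cases hE0 : P E = 0
  · exact Or.inr (measure_eq_zero_iff_ae_notMem.1 hE0)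
  by_cases hE1 : P Eᶜ = 0
  · exact Or.inl (by simpa using measure_eq_zero_iff_ae_notMem.1 hE1)
  have hcond : ∀ F : Set (ℕ → α), MeasurableSet F → P F ≠ 0 →
      (∀ n σ, FixesFrom n σ → ∀ w, permWord σ w ∈ F ↔ w ∈ F) →
      (P F)⁻¹ • P.restrict F ∈ qExchangeableMeasures α q := by
    intro F hF hF0 hFinv
    refine ⟨⟨?_⟩, isQExchangeable_cond h0 hexch hF hFinv⟩
    rw [Measure.smul_apply, Measure.restrict_apply_univ, smul_eq_mul,
      ENNReal.inv_mul_cancel hF0 (measure_ne_top P F)]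
  have hscale : ∀ F : Set (ℕ → α), P F ≠ 0 →
      (P F).toNNReal • ((P F)⁻¹ • P.restrict F) = P.restrict F := by
    intro F hF0
    ext S _
    rw [Measure.smul_apply, Measure.smul_apply, ENNReal.smul_def,
      ENNReal.coe_toNNReal (measure_ne_top P F), smul_eq_mul, smul_eq_mul, ← mul_assoc,
      ENNReal.mul_inv_cancel hF0 (measure_ne_top P F), one_mul]
  have hpos : ∀ F : Set (ℕ → α), P F ≠ 0 → 0 < (P F).toNNReal := fun F hF =>
    ENNReal.toNNReal_pos hF (measure_ne_top P F)
  have hseg : P ∈ openSegment ℝ≥0 ((P E)⁻¹ • P.restrict E) ((P Eᶜ)⁻¹ • P.restrict Eᶜ) := by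
    refine ⟨_, _, hpos E hE0, hpos Eᶜ hE1, ?_, ?_⟩
    · rw [← ENNReal.toNNReal_add (measure_ne_top P E) (measure_ne_top P Eᶜ),
        measure_add_measure_compl hE, measure_univ, ENNReal.toNNReal_one]
    · rw [hscale E hE0, hscale Eᶜ hE1, Measure.restrict_add_restrict_compl hE]
  have heq := (hext _ (hcond E hE hE0 hinv) _
    (hcond Eᶜ hE.compl hE1 fun n σ hσ w => not_congr (hinv n σ hσ w)) hseg).1
  refine absurd ?_ hE1
  rw [← heq, Measure.smul_apply, Measure.restrict_apply hE.compl]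
  simp

theorem mem_extremePoints_of_ae_sortsTo {v : ℕ → α} (hv : Monotone v)
    (hs : ∀ᵐ w ∂shuffleLaw q h0 h1 v, SortsTo w v) :
    shuffleLaw q h0 h1 v ∈ Set.extremePoints ℝ≥0 (qExchangeableMeasures α q) := by
  refine mem_extremePoints.2 ⟨⟨isProbabilityMeasure_shuffleLaw q h0 h1 v,
    isQExchangeable_shuffleLaw h0 h1 hv⟩, ?_⟩
  have key : ∀ P ∈ qExchangeableMeasures α q, ∀ (a : ℝ≥0) (R : Measure (ℕ → α)), 0 < a →
      a • P + R = shuffleLaw q h0 h1 v → P = shuffleLaw q h0 h1 v := by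
    rintro P ⟨hprob, hexch⟩ a R ha hPR
    refine eq_shuffleLaw_of_ae_sortsTo h0 h1 hexch ?_
    -- A null set of the mixture is null for each component with positive coefficient, even if it is
    -- not known to be measurable.
    have hz : (a • P + R) {w | ¬ SortsTo w v} = 0 := by
      rw [hPR]
      exact hs
    rw [Measure.add_apply, add_eq_zero, Measure.smul_apply, ENNReal.smul_def, smul_eq_mul,
      mul_eq_zero] at hz
    exact hz.1.resolve_left (by simpa using ha.ne')
  rintro P₁ hP₁ P₂ hP₂ ⟨a, b, ha, hb, -, hab⟩
  exact ⟨key P₁ hP₁ a _ ha hab, key P₂ hP₂ b _ hb (by rw [add_comm]; exact hab)⟩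

end Uniqueness

/-! ### Extreme measures have a constant sorted word -/

section RealLetters

variable {A : Set ℝ} {q : ℝ} (h0 : 0 < q) (h1 : q < 1)

include h0 h1 in
theorem exists_ae_sortsTo_of_mem_extremePoints {P : Measure (ℕ → A)}
    (hP : P ∈ Set.extremePoints ℝ≥0 (qExchangeableMeasures A q)) :
    ∃ v : ℕ → A, Monotone v ∧ ∀ᵐ w ∂P, SortsTo w v := by
  obtain ⟨hprob, hexch⟩ := hP.1
  set E : ℚ → ℕ → Set (ℕ → A) := fun x j =>
    {w | ∃ n, j < letterCount (fun a : A => (a : ℝ) ≤ x) n w} with hE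
  have htriv : ∀ x j, ∃ b : Prop, ∀ᵐ w ∂P, w ∈ E x j ↔ b := by
    intro x j
    rcases ae_mem_or_ae_notMem_of_mem_extremePoints h0 hP
      (measurableSet_exists_lt_letterCount (measurableSet_coe_le (A := A) (x : ℝ)) j)
      fun n σ hσ w => exists_lt_letterCount_permWord _ j hσ w with h | h
    · exact ⟨True, h.mono fun w hw => iff_true_intro hw⟩
    · exact ⟨False, h.mono fun w hw => iff_false_intro hw⟩
  choose b hb using htriv
  have hall : ∀ᵐ w ∂P, (∀ x j, w ∈ E x j ↔ b x j) ∧ ∃ v, SortsTo w v :=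
    (ae_all_iff.2 fun x => ae_all_iff.2 fun j => hb x j).and (ae_exists_sortsTo h0 h1 hexch)
  -- The sorted word of one typical `w₀` serves for all: almost all words share its threshold
  -- events.
  obtain ⟨w₀, hw₀, v, hv⟩ := hall.exists
  refine ⟨v, hv.1, ?_⟩
  filter_upwards [hall] with w hw
  obtain ⟨hwE, v', hv'⟩ := hw
  have : v' = v := hv'.eq_of_forall_rat fun x j => by
    rw [← hv.iff (p := fun a : A => (a : ℝ) ≤ x)
      (fun a b hab hb => le_trans (Subtype.coe_le_coe.2 hab) hb) j]
    exact (hwE x j).trans (hw₀ x j).symm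
  rwa [this] at hv'

end RealLetters

end QExch


theorem theorem4 (A : Set ℝ) (hA : MeasurableSet A) (q : ℝ) (h0 : 0 < q) (h1 : q < 1) :
    Set.BijOn (fun v : ℕ → A => QExch.shuffleLaw q h0 h1 v)
      {v : ℕ → A | Monotone v}
      (Set.extremePoints ℝ≥0 (QExch.qExchangeableMeasures A q)) := by
  refine ⟨fun v hv => QExch.mem_extremePoints_of_ae_sortsTo h0 h1 hv
    (QExch.ae_shuffleLaw_sortsTo h0 h1 hv), fun v hv v' hv' heq => ?_, fun P hP => ?_⟩
  · have := QExch.isProbabilityMeasure_shuffleLaw q h0 h1 v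
    have hs := QExch.ae_shuffleLaw_sortsTo h0 h1 hv
    have hs' := QExch.ae_shuffleLaw_sortsTo h0 h1 hv'
    simp only at heq
    rw [← heq] at hs'
    -- Equal laws provide one word sorting to both `v` and `v'`.
    obtain ⟨w, hw, hw'⟩ := (hs.and hs').exists
    funext j
    obtain ⟨n, hn, hn'⟩ := ((hw.2 j).and (hw'.2 j)).exists
    rw [← hn, hn']
  · obtain ⟨v, hv, hs⟩ := QExch.exists_ae_sortsTo_of_mem_extremePoints h0 h1 hP
    have : IsProbabilityMeasure P := hP.1.1
    exact ⟨v, hv, (QExch.eq_shuffleLaw_of_ae_sortsTo h0 h1 hP.1.2 hs).symm⟩
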